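/- Let $\mathbb F$ be an algebraically closed field of characteristic zero. A Hom-Lie superalgebra structure on a Lie superalgebra $\mathfrak g=\mathfrak g_{\bar 0}\oplus\mathfrak g_{\bar 1}$ over $\mathbb F$ is an even linear map $\sigma:\mathfrak g\to\mathfrak g$ with $$\sigma[x,y]=[\sigma(x),\sigma(y)],\qquad (-1)^{|x||z|}[\sigma(x),[y,z]]+(-1)^{|y||x|}[\sigma(y),[z,x]]+(-1)^{|z||y|}[\sigma(z),[x,y]]=0$$ for all homogeneous $x,y,z\in\mathfrak g$. All vector fields and differential forms below have coefficients in the polynomial ring, or, alternatively, in the ring of formal power series, over $\mathbb F$; the statement holds for either choice. Write $\mathrm d_{ij}=\mathrm dx_i\wedge \mathrm dx_j$. * $E(5,10)$: the even part consists of the vector fields of divergence zero in $x_1,\dots,x_5$, the odd part of the closed 2-forms in $x_1,\dots,x_5$. Vector fields act on each other by the commutator and on forms by the Lie derivative, and $[f\,\mathrm d_{ij},g\,\mathrm d_{kl}]=\varepsilon_{tijkl}\,fg\,\partial_t$ (extended bilinearly), where $\varepsilon_{tijkl}$ is the sign of the permutation $(tijkl)$ if $\{t,i,j,k,l\}=\{1,\dots,5\}$,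 and the bracket is zero if $i,j,k,l$ are not distinct. The $\mathbb Z$-grading is given by $\deg x_i=2=-\deg\partial_i$, $\deg \mathrm dx_i=-\tfrac12$. Thus $\mathfrak g_{-1}=\langle \mathrm d_{ij}\mid 1\le i<j\le 5\rangle$ and $\mathfrak g_0=\langle x_i\partial_j,\ x_k\partial_k-x_{k+1}\partial_{k+1}\mid i\ne j\rangle\simeq\mathfrak{sl}(5)$. * $E(3,6)$: the subalgebra of $E(5,10)$ of elements of degree $0$ for the second grading $\deg x_1=\deg x_2=\deg x_3=0$, $\deg x_4=\deg x_5=1$, $\deg \mathrm d=-\tfrac12$ (so $\deg \partial_i=-\deg x_i$, $\deg \mathrm d_{ij}=\deg x_i+\deg x_j-1$), with the $\mathbb Z$-grading induced by that of $E(5,10)$. Thus $\mathfrak g_{-1}=\langle \mathrm d_{ij}\mid i=1,2,3,\ j=4,5\rangle$, and $\mathfrak g_0\simeq\mathfrak{gl}(3)\oplus\mathfrak{sl}(2)$ consists of the divergence-free fields in the span of $x_i\partial_j$ $(i,j\le 3)$ and $x_k\partial_l$ $(k,l\ge 4)$. * $E(3,8)$: in the variables $x_1,x_2,x_3$, let $W_3$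 be the vector fields, $\Omega^k$ the $k$-forms. The even part is $W_3\oplus(\Omega^0\otimes\mathfrak{sl}(2))\oplus \mathrm d\Omega^1$, the odd part is $(\Omega^0\otimes\mathbb F^2)\oplus(\Omega^2\otimes\mathbb F^2)$. For $X,Y\in W_3$; $f,g,h\in\Omega^0$; $A,B\in\mathfrak{sl}(2)$; $\omega,\omega'\in \mathrm d\Omega^1$; $\rho,\tau\in\Omega^2$; $u,v\in\mathbb F^2$, the bracket is given by $$[X,Y]=XY-YX-\tfrac12\,\mathrm d(\mathrm{div}X)\wedge \mathrm d(\mathrm{div}Y),\quad [X,f\otimes A]=X(f)\otimes A,\quad [X,\omega]=L_X\omega,$$ $$[f\otimes A,g\otimes B]=fg\otimes[A,B]+\mathrm{tr}(AB)\,\mathrm df\wedge \mathrm dg,\quad [f\otimes A,\omega]=[\omega,\omega']=0,$$ $$[X,h\otimes v]=\big(X(h)-\tfrac12(\mathrm{div}X)h+\tfrac12\,\mathrm d(\mathrm{div}X)\wedge \mathrm dh\big)\otimes v,\quad [X,\rho\otimes v]=\big(L_X\rho-\tfrac12(\mathrm{div}X)\rho\big)\otimes v,$$ $$[f\otimes A,h\otimes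 v]=(fh+\mathrm df\wedge \mathrm dh)\otimes Av,\quad [f\otimes A,\rho\otimes v]=f\rho\otimes Av,\quad [\omega,h\otimes v]=h\omega\otimes v,\quad [\omega,\rho\otimes v]=0,$$ $$[g\otimes u,h\otimes v]=\det(u,v)\,(\mathrm dg\wedge \mathrm dh)^\sharp,\qquad [\rho\otimes u,\tau\otimes v]=-\det(u,v)\,\mathrm d(\rho^\sharp\times\tau^\sharp),$$ $$[h\otimes u,\rho\otimes v]=\det(u,v)\big(h\rho^\sharp-\mathrm d(\star \mathrm d\rho)\wedge \mathrm dh\big)+\tfrac12\,{\star}(\mathrm dh\wedge\rho-h\,\mathrm d\rho)\otimes(u\cdot v),$$ and super-skew-symmetry, where $\star(f\,\mathrm dx_1\wedge \mathrm dx_2\wedge \mathrm dx_3)=f$, $\rho\mapsto\rho^\sharp$ is the identification $\Omega^2\simeq W_3$ with $\mathrm dx_2\wedge \mathrm dx_3\mapsto\partial_1$ and cyclically, $X\times Y$ is the 1-form whose coefficients are those of the cross product, and $u\cdot v\in\mathfrak{sl}(2)$ is $w\mapsto\det(u,w)v+\det(v,w)u$. The $\mathbb Z$-grading is given by $\deg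 x_i=-\deg\partial_i=\deg \mathrm dx_i=2$, $\deg\mathfrak{sl}(2)=0$, $\deg\mathbb F^2=-3$. Thus $\mathfrak g_{-1}=\langle x_i\rangle\otimes\mathbb F^2\simeq\mathbb F^3\otimes\mathbb F^2$ and $\mathfrak g_0=\langle x_i\partial_j\rangle\oplus\mathfrak{sl}(2)\simeq\mathfrak{gl}(3)\oplus\mathfrak{sl}(2)$. **Theorem.** Let $\mathfrak g$ be $E(5,10)$, $E(3,6)$ or $E(3,8)$, and let $\sigma\neq0$ be a Hom-Lie superalgebra structure on $\mathfrak g$. Then $$\sigma|_{\mathfrak g_{-1}}=\mathrm{id}|_{\mathfrak g_{-1}}\qquad\text{and}\qquad \sigma|_{\mathfrak g_0}=\mathrm{id}|_{\mathfrak g_0}.$$ -/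

import Mathlib

open MvPowerSeries

noncomputable section

namespace ExcLie

/-! ### Hom-Lie superalgebra structures -/

/-- `σ` is a Hom-Lie superalgebra structure on the superspace `V = parity 0 ⊕ parity 1` with the
bilinear product `br`: the product and `σ` are even, `σ` is multiplicative, the product is
super-skew-symmetric, and the Hom-Jacobi identity holds. -/
structure IsHomLieStructure {F V : Type*} [Field F] [AddCommGroup V] [Module F V]
    (parity : ZMod 2 → Submodule F V) (br : V →ₗ[F] V →ₗ[F] V) (σ : V →ₗ[F] V) : Prop where
  bracket_even : ∀ (i j : ZMod 2), ∀ x ∈ parity i, ∀ y ∈ parity j, br x y ∈ parity (i + j)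
  map_even : ∀ i : ZMod 2, ∀ x ∈ parity i, σ x ∈ parity i
  map_bracket : ∀ (i j : ZMod 2), ∀ x ∈ parity i, ∀ y ∈ parity j, σ (br x y) = br (σ x) (σ y)
  skew : ∀ (i j : ZMod 2), ∀ x ∈ parity i, ∀ y ∈ parity j,
    br x y = -((-1 : F) ^ (i.val * j.val) • br y x)
  hom_jacobi : ∀ (i j k : ZMod 2), ∀ x ∈ parity i, ∀ y ∈ parity j, ∀ z ∈ parity k,
    (-1 : F) ^ (i.val * k.val) • br (σ x) (br y z)
      + (-1 : F) ^ (j.val * i.val) • br (σ y) (br z x)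
      + (-1 : F) ^ (k.val * j.val) • br (σ z) (br x y) = 0

/-- The bilinear product on `A × B` (`A` even, `B` odd) with the given products even-even,
even-odd and odd-odd; the product odd-even is minus the product even-odd. -/
def superBracket {F A B : Type*} [Field F] [AddCommGroup A] [Module F A] [AddCommGroup B]
    [Module F B] (ee : A →ₗ[F] A →ₗ[F] A) (eo : A →ₗ[F] B →ₗ[F] B) (oo : B →ₗ[F] B →ₗ[F] A) :
    (A × B) →ₗ[F] (A × B) →ₗ[F] (A × B) :=
  LinearMap.mk₂ F (fun x y => (ee x.1 y.1 + oo x.2 y.2, eo x.1 y.2 - eo y.1 x.2))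
    (by intro x y z; ext <;> simp <;> abel)
    (by intro c x y; ext <;> simp [smul_sub])
    (by intro x y z; ext <;> simp <;> abel)
    (by intro c x y; ext <;> simp [smul_sub])

/-- The `ℤ/2`-grading of a subspace of `A × B`: even part in `A`, odd part in `B`. -/
def parityOn {F A B : Type*} [Field F] [AddCommGroup A] [Module F A] [AddCommGroup B]
    [Module F B] (S : Submodule F (A × B)) (i : ZMod 2) : Submodule F S :=
  if i = 0 then (LinearMap.ker (LinearMap.snd F A B)).comap S.subtype
  else (LinearMap.ker (LinearMap.fst F A B)).comap S.subtype

/-- Restriction of a bilinear product to a subspace closed under it. -/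
def restrictBracket {F V : Type*} [Field F] [AddCommGroup V] [Module F V]
    (br : V →ₗ[F] V →ₗ[F] V) (S : Submodule F V) (h : ∀ x ∈ S, ∀ y ∈ S, br x y ∈ S) :
    S →ₗ[F] S →ₗ[F] S :=
  LinearMap.mk₂ F (fun x y => ⟨br x y, h x x.2 y y.2⟩)
    (by intro x y z; ext; simp)
    (by intro c x y; ext; simp)
    (by intro x y z; ext; simp)
    (by intro c x y; ext; simp)

/-! ### Coefficients -/

/-- The two customary choices of coefficients. -/
inductive CoeffKind
  | formal
  | polynomial

/-- All formal power series in `n` variables, or those that are polynomials. -/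
def coeffRing (F : Type*) [Field F] (n : ℕ) : CoeffKind → Subalgebra F (MvPowerSeries (Fin n) F)
  | .formal => ⊤
  | .polynomial => (MvPolynomial.coeToMvPowerSeries.algHom (σ := Fin n) (R := F) F).range

theorem pderiv_mem_coeffRing {F : Type*} [Field F] {n : ℕ} (c : CoeffKind) (i : Fin n)
    {f : MvPowerSeries (Fin n) F} (hf : f ∈ coeffRing F n c) :
    pderiv F i f ∈ coeffRing F n c := by
  cases c with
  | formal => exact Algebra.mem_top
  | polynomial =>
    obtain ⟨p, rfl⟩ := hf
    refine ⟨MvPolynomial.pderiv i p, ?_⟩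
    simp [MvPolynomial.coeToMvPowerSeries.algHom_apply, pderiv_coe]

theorem pderiv_comm {F : Type*} [Field F] {n : ℕ} (i j : Fin n) (f : MvPowerSeries (Fin n) F) :
    pderiv F i (pderiv F j f) = pderiv F j (pderiv F i f) := by
  ext m
  by_cases h : i = j
  · rw [h]
  · have h' : j ≠ i := fun e => h e.symm
    simp only [coeff_pderiv, Finsupp.add_apply, Finsupp.single_apply, if_neg h, if_neg h',
      add_right_comm m (Finsupp.single i 1)]
    push_cast
    ring

/-- `f` is homogeneous of degree `p` when the variable `x_i` has degree `w i`. -/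
def IsHom {F : Type*} [Field F] {n : ℕ} (w : Fin n → ℤ) (p : ℤ)
    (f : MvPowerSeries (Fin n) F) : Prop :=
  ∀ m : Fin n →₀ ℕ, coeff m f ≠ 0 → ∑ i, (m i : ℤ) * w i = p

/-! ### Vector fields and differential 2-forms -/

section Calculus

variable {F : Type*} [Field F] {n : ℕ}

/-- The divergence of the vector field `∑ X_i ∂_i`. -/
def divergence (X : Fin n → MvPowerSeries (Fin n) F) : MvPowerSeries (Fin n) F :=
  ∑ i, pderiv F i (X i)

/-- The action of the vector field `∑ X_i ∂_i` on functions. -/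
def actFun (X : Fin n → MvPowerSeries (Fin n) F) (f : MvPowerSeries (Fin n) F) :
    MvPowerSeries (Fin n) F :=
  ∑ k, X k * pderiv F k f

/-- The commutator of vector fields. -/
def lieVec (X Y : Fin n → MvPowerSeries (Fin n) F) : Fin n → MvPowerSeries (Fin n) F :=
  fun i => actFun X (Y i) - actFun Y (X i)

/-- A 2-form `∑_{i<j} ω_ij dx_i ∧ dx_j` is given by its coefficients, `ω_ji = -ω_ij`. -/
def IsSkew (ω : Fin n → Fin n → MvPowerSeries (Fin n) F) : Prop :=
  ∀ i j, ω j i = -ω i j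

/-- `dω = 0`. -/
def IsClosedForm (ω : Fin n → Fin n → MvPowerSeries (Fin n) F) : Prop :=
  ∀ i j k, pderiv F i (ω j k) + pderiv F j (ω k i) + pderiv F k (ω i j) = 0

/-- The Lie derivative of a 2-form along a vector field. -/
def lieForm (X : Fin n → MvPowerSeries (Fin n) F)
    (ω : Fin n → Fin n → MvPowerSeries (Fin n) F) : Fin n → Fin n → MvPowerSeries (Fin n) F :=
  fun i j => actFun X (ω i j) + ∑ k, (pderiv F i (X k) * ω k j + pderiv F j (X k) * ω i k)

/-- The 2-form `df ∧ dg`. -/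
def dWedge (f g : MvPowerSeries (Fin n) F) : Fin n → Fin n → MvPowerSeries (Fin n) F :=
  fun i j => pderiv F i f * pderiv F j g - pderiv F j f * pderiv F i g

/-- The differential of the 1-form `∑ θ_i dx_i`. -/
def dOne (θ : Fin n → MvPowerSeries (Fin n) F) : Fin n → Fin n → MvPowerSeries (Fin n) F :=
  fun i j => pderiv F i (θ j) - pderiv F j (θ i)

theorem divergence_add (X Y : Fin n → MvPowerSeries (Fin n) F) :
    divergence (X + Y) = divergence X + divergence Y := by
  simp [divergence, Finset.sum_add_distrib]

theorem divergence_smul (c : F) (X : Fin n → MvPowerSeries (Fin n) F) :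
    divergence (c • X) = c • divergence X := by
  simp [divergence, Finset.smul_sum]

theorem actFun_add_left (X Y : Fin n → MvPowerSeries (Fin n) F) (f : MvPowerSeries (Fin n) F) :
    actFun (X + Y) f = actFun X f + actFun Y f := by
  simp [actFun, add_mul, Finset.sum_add_distrib]

theorem actFun_smul_left (c : F) (X : Fin n → MvPowerSeries (Fin n) F)
    (f : MvPowerSeries (Fin n) F) : actFun (c • X) f = c • actFun X f := by
  simp [actFun, Finset.smul_sum]

theorem actFun_add_right (X : Fin n → MvPowerSeries (Fin n) F) (f g : MvPowerSeries (Fin n) F) :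
    actFun X (f + g) = actFun X f + actFun X g := by
  simp [actFun, mul_add, Finset.sum_add_distrib]

theorem actFun_smul_right (c : F) (X : Fin n → MvPowerSeries (Fin n) F)
    (f : MvPowerSeries (Fin n) F) : actFun X (c • f) = c • actFun X f := by
  simp [actFun, Finset.smul_sum]

/-- The commutator of vector fields as a bilinear map. -/
def lieVecₗ : (Fin n → MvPowerSeries (Fin n) F) →ₗ[F] (Fin n → MvPowerSeries (Fin n) F) →ₗ[F]
    (Fin n → MvPowerSeries (Fin n) F) :=
  LinearMap.mk₂ F lieVec
    (by intro x y z; ext1 i; simp [lieVec, actFun_add_left, actFun_add_right]; abel)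
    (by intro c x y; ext1 i; simp [lieVec, actFun_smul_left, actFun_smul_right, smul_sub])
    (by intro x y z; ext1 i; simp [lieVec, actFun_add_left, actFun_add_right]; abel)
    (by intro c x y; ext1 i; simp [lieVec, actFun_smul_left, actFun_smul_right, smul_sub])

/-- The Lie derivative of 2-forms as a bilinear map. -/
def lieFormₗ : (Fin n → MvPowerSeries (Fin n) F) →ₗ[F]
    (Fin n → Fin n → MvPowerSeries (Fin n) F) →ₗ[F] (Fin n → Fin n → MvPowerSeries (Fin n) F) :=
  LinearMap.mk₂ F lieForm
    (by intro x y z; ext1 i; ext1 j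
        simp [lieForm, actFun_add_left, add_mul, Finset.sum_add_distrib]; abel)
    (by intro c x y; ext1 i; ext1 j
        simp [lieForm, actFun_smul_left, Finset.smul_sum, smul_add])
    (by intro x y z; ext1 i; ext1 j
        simp [lieForm, actFun_add_right, mul_add, Finset.sum_add_distrib]; abel)
    (by intro c x y; ext1 i; ext1 j
        simp [lieForm, actFun_smul_right, Finset.smul_sum, smul_add])

theorem divergence_lieVec (X Y : Fin n → MvPowerSeries (Fin n) F) :
    divergence (lieVec X Y) = actFun X (divergence Y) - actFun Y (divergence X) := by
  simp only [divergence, lieVec, actFun, map_sub, map_sum, Derivation.leibniz, smul_eq_mul,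
    Finset.mul_sum, Finset.sum_sub_distrib, Finset.sum_add_distrib]
  have h1 : ∀ A B : Fin n → MvPowerSeries (Fin n) F,
      ∑ i, ∑ k, A k * pderiv F i (pderiv F k (B i)) =
        ∑ k, ∑ i, A k * pderiv F k (pderiv F i (B i)) := by
    intro A B
    rw [Finset.sum_comm]
    simp only [pderiv_comm]
  have h2 : ∑ i, ∑ k, pderiv F k (Y i) * pderiv F i (X k) =
      ∑ i, ∑ k, pderiv F k (X i) * pderiv F i (Y k) := by
    rw [Finset.sum_comm]
    simp only [mul_comm]
  rw [h1, h1, h2]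
  ring

theorem isSkew_lieForm (X : Fin n → MvPowerSeries (Fin n) F)
    {ω : Fin n → Fin n → MvPowerSeries (Fin n) F} (h : IsSkew ω) : IsSkew (lieForm X ω) := by
  intro i j
  simp only [lieForm, actFun, ← Finset.sum_add_distrib, ← Finset.sum_neg_distrib]
  refine Finset.sum_congr rfl fun k _ => ?_
  rw [h i j, h i k, h k j, map_neg]
  ring

theorem isClosedForm_lieForm (X : Fin n → MvPowerSeries (Fin n) F)
    {ω : Fin n → Fin n → MvPowerSeries (Fin n) F} (h : IsSkew ω) (hc : IsClosedForm ω) :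
    IsClosedForm (lieForm X ω) := by
  intro i j k
  simp only [lieForm, actFun, ← Finset.sum_add_distrib, map_sum]
  refine Finset.sum_eq_zero fun m _ => ?_
  have hX := congrArg (pderiv F m) (hc i j k)
  simp only [map_add, map_zero] at hX
  simp only [map_add, Derivation.leibniz, smul_eq_mul]
  rw [pderiv_comm i m, pderiv_comm j m, pderiv_comm k m, pderiv_comm j i, pderiv_comm k i,
    pderiv_comm k j, h m k, h m j, h m i]
  have e1 := hc m j k
  have e2 := hc m k i
  have e3 := hc m i j
  rw [h m k, map_neg] at e1
  rw [h m i, map_neg] at e2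
  rw [h m j, map_neg] at e3
  simp only [map_neg]
  linear_combination X m * hX + pderiv F i (X m) * e1 + pderiv F j (X m) * e2
    + pderiv F k (X m) * e3

theorem isSkew_dOne (θ : Fin n → MvPowerSeries (Fin n) F) : IsSkew (dOne θ) := by
  intro i j
  simp [dOne]

theorem isClosedForm_dOne (θ : Fin n → MvPowerSeries (Fin n) F) : IsClosedForm (dOne θ) := by
  intro i j k
  simp only [dOne, map_sub]
  rw [pderiv_comm j i, pderiv_comm k i, pderiv_comm k j]
  ring

theorem isSkew_dWedge (f g : MvPowerSeries (Fin n) F) : IsSkew (dWedge f g) := by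
  intro i j
  simp only [dWedge]
  ring

theorem isClosedForm_dWedge (f g : MvPowerSeries (Fin n) F) : IsClosedForm (dWedge f g) := by
  intro i j k
  simp only [dWedge, map_sub, Derivation.leibniz, smul_eq_mul]
  rw [pderiv_comm j i, pderiv_comm k i, pderiv_comm k j, pderiv_comm j i, pderiv_comm k i,
    pderiv_comm k j]
  ring

theorem divergence_mem {c : CoeffKind} {X : Fin n → MvPowerSeries (Fin n) F}
    (hX : ∀ i, X i ∈ coeffRing F n c) : divergence X ∈ coeffRing F n c :=
  sum_mem fun i _ => pderiv_mem_coeffRing c i (hX i)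

theorem actFun_mem {c : CoeffKind} {X : Fin n → MvPowerSeries (Fin n) F}
    {f : MvPowerSeries (Fin n) F} (hX : ∀ i, X i ∈ coeffRing F n c) (hf : f ∈ coeffRing F n c) :
    actFun X f ∈ coeffRing F n c :=
  sum_mem fun i _ => mul_mem (hX i) (pderiv_mem_coeffRing c i hf)

theorem lieVec_mem {c : CoeffKind} {X Y : Fin n → MvPowerSeries (Fin n) F}
    (hX : ∀ i, X i ∈ coeffRing F n c) (hY : ∀ i, Y i ∈ coeffRing F n c) (i : Fin n) :
    lieVec X Y i ∈ coeffRing F n c :=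
  sub_mem (actFun_mem hX (hY i)) (actFun_mem hY (hX i))

theorem lieForm_mem {c : CoeffKind} {X : Fin n → MvPowerSeries (Fin n) F}
    {ω : Fin n → Fin n → MvPowerSeries (Fin n) F} (hX : ∀ i, X i ∈ coeffRing F n c)
    (hω : ∀ i j, ω i j ∈ coeffRing F n c) (i j : Fin n) :
    lieForm X ω i j ∈ coeffRing F n c :=
  add_mem (actFun_mem hX (hω i j)) (sum_mem fun k _ =>
    add_mem (mul_mem (pderiv_mem_coeffRing c i (hX k)) (hω k j))
      (mul_mem (pderiv_mem_coeffRing c j (hX k)) (hω i k)))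

theorem dWedge_mem {c : CoeffKind} {f g : MvPowerSeries (Fin n) F} (hf : f ∈ coeffRing F n c)
    (hg : g ∈ coeffRing F n c) (i j : Fin n) : dWedge f g i j ∈ coeffRing F n c :=
  sub_mem (mul_mem (pderiv_mem_coeffRing c i hf) (pderiv_mem_coeffRing c j hg))
    (mul_mem (pderiv_mem_coeffRing c j hf) (pderiv_mem_coeffRing c i hg))

theorem dOne_mem {c : CoeffKind} {θ : Fin n → MvPowerSeries (Fin n) F}
    (hθ : ∀ i, θ i ∈ coeffRing F n c) (i j : Fin n) : dOne θ i j ∈ coeffRing F n c :=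
  sub_mem (pderiv_mem_coeffRing c i (hθ j)) (pderiv_mem_coeffRing c j (hθ i))

theorem IsHom.zero (w : Fin n → ℤ) (p : ℤ) : IsHom w p (0 : MvPowerSeries (Fin n) F) :=
  fun m h => absurd (by simp) h

theorem IsHom.add {w : Fin n → ℤ} {p : ℤ} {f g : MvPowerSeries (Fin n) F} (hf : IsHom w p f)
    (hg : IsHom w p g) : IsHom w p (f + g) := by
  intro m h
  by_cases hx : coeff m f = 0
  · exact hg m fun hy => h (by simp [hx, hy])
  · exact hf m hx

theorem IsHom.neg {w : Fin n → ℤ} {p : ℤ} {f : MvPowerSeries (Fin n) F} (hf : IsHom w p f) :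
    IsHom w p (-f) :=
  fun m h => hf m fun hx => h (by simp [hx])

theorem IsHom.sub {w : Fin n → ℤ} {p : ℤ} {f g : MvPowerSeries (Fin n) F} (hf : IsHom w p f)
    (hg : IsHom w p g) : IsHom w p (f - g) := by
  rw [sub_eq_add_neg]
  exact hf.add hg.neg

theorem IsHom.smul {w : Fin n → ℤ} {p : ℤ} {f : MvPowerSeries (Fin n) F} (a : F)
    (hf : IsHom w p f) : IsHom w p (a • f) :=
  fun m h => hf m fun hx => h (by simp [hx])

theorem IsHom.zsmul {w : Fin n → ℤ} {p : ℤ} {f : MvPowerSeries (Fin n) F} (a : ℤ)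
    (hf : IsHom w p f) : IsHom w p (a • f) :=
  fun m h => hf m fun hx => h (by rw [map_zsmul, hx, smul_zero])

theorem IsHom.sum {w : Fin n → ℤ} {p : ℤ} {ι : Type*} (s : Finset ι)
    {f : ι → MvPowerSeries (Fin n) F} (hf : ∀ i ∈ s, IsHom w p (f i)) :
    IsHom w p (∑ i ∈ s, f i) := by
  intro m h
  rw [map_sum] at h
  obtain ⟨i, hi, hne⟩ := Finset.exists_ne_zero_of_sum_ne_zero h
  exact hf i hi m hne

theorem IsHom.mul {w : Fin n → ℤ} {p q r : ℤ} {f g : MvPowerSeries (Fin n) F}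
    (hf : IsHom w p f) (hg : IsHom w q g) (hr : p + q = r) : IsHom w r (f * g) := by
  classical
  intro m h
  rw [coeff_mul] at h
  obtain ⟨⟨a, b⟩, hab, hne⟩ := Finset.exists_ne_zero_of_sum_ne_zero h
  have hm : a + b = m := Finset.HasAntidiagonal.mem_antidiagonal.mp hab
  rw [← hr, ← hf a (left_ne_zero_of_mul hne), ← hg b (right_ne_zero_of_mul hne), ← hm,
    ← Finset.sum_add_distrib]
  refine Finset.sum_congr rfl fun i _ => ?_
  simp [add_mul]

theorem IsHom.pderiv {w : Fin n → ℤ} {p : ℤ} {f : MvPowerSeries (Fin n) F}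
    (hf : IsHom w p f) (k : Fin n) : IsHom w (p - w k) (MvPowerSeries.pderiv F k f) := by
  classical
  intro m h
  rw [coeff_pderiv] at h
  rw [← hf _ (left_ne_zero_of_mul h)]
  simp [add_mul, Finset.sum_add_distrib, Finsupp.single_apply]

theorem IsHom.actFun {w : Fin n → ℤ} {p q r : ℤ} {X : Fin n → MvPowerSeries (Fin n) F}
    {f : MvPowerSeries (Fin n) F} (hX : ∀ i, IsHom w (p + w i) (X i)) (hf : IsHom w q f)
    (hr : p + q = r) : IsHom w r (actFun X f) :=
  IsHom.sum _ fun k _ => (hX k).mul (hf.pderiv k) (by rw [← hr]; ring)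

theorem lieForm_add_left (X Y : Fin n → MvPowerSeries (Fin n) F)
    (ω : Fin n → Fin n → MvPowerSeries (Fin n) F) (i j : Fin n) :
    lieForm (X + Y) ω i j = lieForm X ω i j + lieForm Y ω i j :=
  congrFun (congrFun (lieFormₗ.map_add₂ X Y ω) i) j

theorem lieForm_smul_left (c : F) (X : Fin n → MvPowerSeries (Fin n) F)
    (ω : Fin n → Fin n → MvPowerSeries (Fin n) F) (i j : Fin n) :
    lieForm (c • X) ω i j = c • lieForm X ω i j :=
  congrFun (congrFun (lieFormₗ.map_smul₂ c X ω) i) j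

theorem lieForm_add_right (X : Fin n → MvPowerSeries (Fin n) F)
    (ω η : Fin n → Fin n → MvPowerSeries (Fin n) F) (i j : Fin n) :
    lieForm X (ω + η) i j = lieForm X ω i j + lieForm X η i j :=
  congrFun (congrFun (map_add (lieFormₗ X) ω η) i) j

theorem lieForm_smul_right (c : F) (X : Fin n → MvPowerSeries (Fin n) F)
    (ω : Fin n → Fin n → MvPowerSeries (Fin n) F) (i j : Fin n) :
    lieForm X (c • ω) i j = c • lieForm X ω i j :=
  congrFun (congrFun (map_smul (lieFormₗ X) c ω) i) j

theorem dWedge_add_left (f g h : MvPowerSeries (Fin n) F) (i j : Fin n) :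
    dWedge (f + g) h i j = dWedge f h i j + dWedge g h i j := by
  simp only [dWedge, map_add]; ring

theorem dWedge_add_right (f g h : MvPowerSeries (Fin n) F) (i j : Fin n) :
    dWedge f (g + h) i j = dWedge f g i j + dWedge f h i j := by
  simp only [dWedge, map_add]; ring

theorem dWedge_smul_left (c : F) (f g : MvPowerSeries (Fin n) F) (i j : Fin n) :
    dWedge (c • f) g i j = c • dWedge f g i j := by
  simp [dWedge, smul_sub]

theorem dWedge_smul_right (c : F) (f g : MvPowerSeries (Fin n) F) (i j : Fin n) :
    dWedge f (c • g) i j = c • dWedge f g i j := by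
  simp [dWedge, smul_sub]

end Calculus

/-! ### E(5,10) -/

section E510

variable (F : Type*) [Field F]

/-- Pairs of a vector field (even) and an array of coefficients of a 2-form (odd) in five
variables. The indices `0, …, 4` stand for `1, …, 5`. -/
abbrev Ambient5 : Type _ :=
  (Fin 5 → MvPowerSeries (Fin 5) F) × (Fin 5 → Fin 5 → MvPowerSeries (Fin 5) F)

/-- `1`, `0`, `-1` according to `a < b`, `a = b`, `a > b`. -/
def sgnDiff (a b : Fin 5) : ℤ := Int.sign ((b : ℤ) - (a : ℤ))

/-- The sign of the permutation `(t i j k l)` of the five indices, zero if two of them agree: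
each pair of entries in the wrong order contributes a factor `-1`. -/
def eps5 (t i j k l : Fin 5) : ℤ :=
  sgnDiff t i * sgnDiff t j * sgnDiff t k * sgnDiff t l * sgnDiff i j * sgnDiff i k
    * sgnDiff i l * sgnDiff j k * sgnDiff j l * sgnDiff k l

variable {F}

/-- The bilinear extension of `[f d_ij, g d_kl] = ε_{tijkl} f g ∂_t`. -/
def formBracket (ω η : Fin 5 → Fin 5 → MvPowerSeries (Fin 5) F) :
    Fin 5 → MvPowerSeries (Fin 5) F :=
  fun t => ∑ i, ∑ j ∈ Finset.Ioi i, ∑ k, ∑ l ∈ Finset.Ioi k,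
    eps5 t i j k l • (ω i j * η k l)

/-- `formBracket` as a bilinear map. -/
def formBracketₗ : (Fin 5 → Fin 5 → MvPowerSeries (Fin 5) F) →ₗ[F]
    (Fin 5 → Fin 5 → MvPowerSeries (Fin 5) F) →ₗ[F] (Fin 5 → MvPowerSeries (Fin 5) F) :=
  LinearMap.mk₂ F formBracket
    (by intro x y z; ext1 t
        simp only [formBracket, Pi.add_apply, add_mul, smul_add, Finset.sum_add_distrib])
    (by intro c x y; ext1 t
        simp only [formBracket, Pi.smul_apply, smul_mul_assoc, Finset.smul_sum, smul_comm c])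
    (by intro x y z; ext1 t
        simp only [formBracket, Pi.add_apply, mul_add, smul_add, Finset.sum_add_distrib])
    (by intro c x y; ext1 t
        simp only [formBracket, Pi.smul_apply, mul_smul_comm, Finset.smul_sum, smul_comm c])

theorem sgnDiff_swap (a b : Fin 5) : sgnDiff b a = -sgnDiff a b := by
  rw [sgnDiff, sgnDiff, ← Int.sign_neg, neg_sub]

theorem sgnDiff_self (a : Fin 5) : sgnDiff a a = 0 := by
  simp [sgnDiff]

theorem eps5_degree {t i j k l : Fin 5} (h : eps5 t i j k l ≠ 0) (w : Fin 5 → ℤ) :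
    w t + w i + w j + w k + w l = ∑ a, w a := by
  have hinj : Function.Injective ![t, i, j, k, l] := by
    have hs : ∀ a b : Fin 5, sgnDiff a b ≠ 0 → a ≠ b := by
      rintro a b hab rfl
      exact hab (sgnDiff_self a)
    simp only [eps5, ne_eq, mul_eq_zero, not_or] at h
    obtain ⟨⟨⟨⟨⟨⟨⟨⟨⟨h1, h2⟩, h3⟩, h4⟩, h5⟩, h6⟩, h7⟩, h8⟩, h9⟩, h10⟩ := h
    have h1 := hs _ _ h1
    have h2 := hs _ _ h2
    have h3 := hs _ _ h3
    have h4 := hs _ _ h4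
    have h5 := hs _ _ h5
    have h6 := hs _ _ h6
    have h7 := hs _ _ h7
    have h8 := hs _ _ h8
    have h9 := hs _ _ h9
    have h10 := hs _ _ h10
    intro a b hab
    fin_cases a <;> fin_cases b <;> simp_all [eq_comm]
  have hb : Function.Bijective ![t, i, j, k, l] := Finite.injective_iff_bijective.mp hinj
  rw [← hb.sum_comp]
  simp [Fin.sum_univ_five]

theorem eps5_swap₁ (t i j k l : Fin 5) : eps5 i t j k l = -eps5 t i j k l := by
  simp only [eps5, sgnDiff_swap t i]
  ring

theorem eps5_swap₂ (t i j k l : Fin 5) : eps5 t j i k l = -eps5 t i j k l := by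
  simp only [eps5, sgnDiff_swap i j]
  ring

theorem eps5_swap_pairs (t i j k l : Fin 5) : eps5 t k l i j = eps5 t i j k l := by
  simp only [eps5]
  rw [sgnDiff_swap i k, sgnDiff_swap i l, sgnDiff_swap j k, sgnDiff_swap j l]
  ring

/-- Contraction of the coefficients of `dω = 0` with an antisymmetric symbol. -/
theorem sum_antisymm_closed {ω : Fin 5 → Fin 5 → MvPowerSeries (Fin 5) F} (hω : IsSkew ω)
    (hω' : IsClosedForm ω) (e : Fin 5 → Fin 5 → Fin 5 → ℤ)
    (h1 : ∀ t i j, e i t j = -e t i j) (h2 : ∀ t i j, e t j i = -e t i j) :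
    ∑ t, ∑ i, ∑ j ∈ Finset.Ioi i, e t i j • pderiv F t (ω i j) = 0 := by
  have I0 : Finset.Ioi (0 : Fin 5) = {1, 2, 3, 4} := by decide
  have I1 : Finset.Ioi (1 : Fin 5) = {2, 3, 4} := by decide
  have I2 : Finset.Ioi (2 : Fin 5) = {3, 4} := by decide
  have I3 : Finset.Ioi (3 : Fin 5) = {4} := by decide
  have I4 : Finset.Ioi (4 : Fin 5) = ∅ := by decide
  have z1 : ∀ t j, e t t j = 0 := fun t j => by have := h1 t t j; omega
  have z2 : ∀ t i, e t i t = 0 := fun t i => by rw [h2, z1, neg_zero]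
  have hcl : ∀ a b c, pderiv F a (ω b c) - pderiv F b (ω a c) + pderiv F c (ω a b) = 0 := by
    intro a b c
    have := hω' a b c
    rw [hω a c, map_neg] at this
    linear_combination this
  have p1 : ∀ a b c, e b a c = -e a b c := h1
  have p2 : ∀ a b c, e c a b = e a b c := fun a b c => by rw [h1, h2, neg_neg]
  simp only [Fin.sum_univ_five, I0, I1, I2, I3, I4]
  simp (decide := true) only [Finset.sum_insert, Finset.sum_singleton, Finset.sum_empty,
    Finset.mem_insert, Finset.mem_singleton, z1, z2, zero_smul, not_false_eq_true]
  rw [p1 0 1 2, p1 0 1 3, p1 0 1 4, p1 0 2 3, p1 0 2 4, p1 0 3 4, p1 1 2 3, p1 1 2 4, p1 1 3 4, p1 2 3 4,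
    p2 0 1 2, p2 0 1 3, p2 0 1 4, p2 0 2 3, p2 0 2 4, p2 0 3 4, p2 1 2 3, p2 1 2 4, p2 1 3 4, p2 2 3 4]
  simp only [zsmul_eq_mul, Int.cast_neg]
  linear_combination
    (e 0 1 2 : MvPowerSeries (Fin 5) F) * hcl 0 1 2
    + (e 0 1 3 : MvPowerSeries (Fin 5) F) * hcl 0 1 3
    + (e 0 1 4 : MvPowerSeries (Fin 5) F) * hcl 0 1 4
    + (e 0 2 3 : MvPowerSeries (Fin 5) F) * hcl 0 2 3
    + (e 0 2 4 : MvPowerSeries (Fin 5) F) * hcl 0 2 4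
    + (e 0 3 4 : MvPowerSeries (Fin 5) F) * hcl 0 3 4
    + (e 1 2 3 : MvPowerSeries (Fin 5) F) * hcl 1 2 3
    + (e 1 2 4 : MvPowerSeries (Fin 5) F) * hcl 1 2 4
    + (e 1 3 4 : MvPowerSeries (Fin 5) F) * hcl 1 3 4
    + (e 2 3 4 : MvPowerSeries (Fin 5) F) * hcl 2 3 4

theorem divergence_formBracket {ω η : Fin 5 → Fin 5 → MvPowerSeries (Fin 5) F}
    (hω : IsSkew ω) (hω' : IsClosedForm ω) (hη : IsSkew η) (hη' : IsClosedForm η) :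
    divergence (formBracket ω η) = 0 := by
  have sw : ∀ G : Fin 5 → Fin 5 → Fin 5 → Fin 5 → MvPowerSeries (Fin 5) F,
      ∑ i, ∑ j ∈ Finset.Ioi i, ∑ k, ∑ l ∈ Finset.Ioi k, G i j k l =
        ∑ k, ∑ l ∈ Finset.Ioi k, ∑ i, ∑ j ∈ Finset.Ioi i, G i j k l := by
    intro G
    rw [Finset.sum_congr rfl fun i _ => Finset.sum_comm, Finset.sum_comm]
    refine Finset.sum_congr rfl fun k _ => ?_
    rw [Finset.sum_congr rfl fun i _ => Finset.sum_comm, Finset.sum_comm]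
  have sw' : ∀ G : Fin 5 → Fin 5 → Fin 5 → Fin 5 → Fin 5 → MvPowerSeries (Fin 5) F,
      ∑ t, ∑ i, ∑ j ∈ Finset.Ioi i, ∑ k, ∑ l ∈ Finset.Ioi k, G t i j k l =
        ∑ i, ∑ j ∈ Finset.Ioi i, ∑ t, ∑ k, ∑ l ∈ Finset.Ioi k, G t i j k l := by
    intro G
    rw [Finset.sum_comm]
    exact Finset.sum_congr rfl fun i _ => Finset.sum_comm
  have sw'' : ∀ G : Fin 5 → Fin 5 → Fin 5 → Fin 5 → Fin 5 → MvPowerSeries (Fin 5) F,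
      ∑ t, ∑ i, ∑ j ∈ Finset.Ioi i, ∑ k, ∑ l ∈ Finset.Ioi k, G t i j k l =
        ∑ k, ∑ l ∈ Finset.Ioi k, ∑ t, ∑ i, ∑ j ∈ Finset.Ioi i, G t i j k l := by
    intro G
    rw [← sw' fun t k l i j => G t i j k l]
    exact Finset.sum_congr rfl fun t _ => sw (G t)
  have e0 : divergence (formBracket ω η) =
      (∑ t, ∑ i, ∑ j ∈ Finset.Ioi i, ∑ k, ∑ l ∈ Finset.Ioi k,
        η k l * (eps5 t i j k l • pderiv F t (ω i j))) +
      ∑ t, ∑ i, ∑ j ∈ Finset.Ioi i, ∑ k, ∑ l ∈ Finset.Ioi k,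
        ω i j * (eps5 t k l i j • pderiv F t (η k l)) := by
    simp only [divergence, formBracket, map_sum, map_zsmul, Derivation.leibniz, smul_eq_mul,
      ← Finset.sum_add_distrib]
    refine Finset.sum_congr rfl fun t _ => Finset.sum_congr rfl fun i _ =>
      Finset.sum_congr rfl fun j _ => Finset.sum_congr rfl fun k _ =>
      Finset.sum_congr rfl fun l _ => ?_
    rw [eps5_swap_pairs t i j k l, mul_smul_comm, mul_smul_comm, ← smul_add, add_comm]
  have e1 : divergence (formBracket ω η) =
      (∑ k, ∑ l ∈ Finset.Ioi k, η k l * ∑ t, ∑ i, ∑ j ∈ Finset.Ioi i,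
        eps5 t i j k l • pderiv F t (ω i j)) +
      ∑ i, ∑ j ∈ Finset.Ioi i, ω i j * ∑ t, ∑ k, ∑ l ∈ Finset.Ioi k,
        eps5 t k l i j • pderiv F t (η k l) := by
    rw [e0, sw'' fun t i j k l => η k l * (eps5 t i j k l • pderiv F t (ω i j)),
      sw' fun t i j k l => ω i j * (eps5 t k l i j • pderiv F t (η k l))]
    simp only [Finset.mul_sum]
  rw [e1]
  have r1 : ∀ k l, ∑ t, ∑ i, ∑ j ∈ Finset.Ioi i, eps5 t i j k l • pderiv F t (ω i j) = 0 :=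
    fun k l => sum_antisymm_closed hω hω' (fun t i j => eps5 t i j k l)
      (fun t i j => eps5_swap₁ t i j k l) (fun t i j => eps5_swap₂ t i j k l)
  have r2 : ∀ i j, ∑ t, ∑ k, ∑ l ∈ Finset.Ioi k, eps5 t k l i j • pderiv F t (η k l) = 0 :=
    fun i j => sum_antisymm_closed hη hη' (fun t k l => eps5 t k l i j)
      (fun t k l => eps5_swap₁ t k l i j) (fun t k l => eps5_swap₂ t k l i j)
  simp only [r1, r2, mul_zero, Finset.sum_const_zero, add_zero]

variable (F)

/-- The product of vector fields and 2-forms: commutator, Lie derivative, `formBracket`. -/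
def bracket5 : Ambient5 F →ₗ[F] Ambient5 F →ₗ[F] Ambient5 F :=
  superBracket lieVecₗ lieFormₗ formBracketₗ

/-- `E(5,10)`: divergence-free vector fields (even) and closed 2-forms (odd). -/
def E510 (c : CoeffKind) : Submodule F (Ambient5 F) where
  carrier := {x | (∀ i, x.1 i ∈ coeffRing F 5 c) ∧ (∀ i j, x.2 i j ∈ coeffRing F 5 c) ∧
    divergence x.1 = 0 ∧ IsSkew x.2 ∧ IsClosedForm x.2}
  zero_mem' := by
    refine ⟨fun i => zero_mem _, fun i j => zero_mem _, ?_, ?_, ?_⟩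
    · simp [divergence]
    · intro i j; simp
    · intro i j k; simp
  add_mem' := by
    rintro x y ⟨h1, h2, h3, h4, h5⟩ ⟨g1, g2, g3, g4, g5⟩
    refine ⟨fun i => add_mem (h1 i) (g1 i), fun i j => add_mem (h2 i j) (g2 i j), ?_, ?_, ?_⟩
    · simp [divergence_add, h3, g3]
    · intro i j
      simp only [Prod.snd_add, Pi.add_apply, h4 i j, g4 i j]; ring
    · intro i j k
      simp only [Prod.snd_add, Pi.add_apply, map_add]
      linear_combination h5 i j k + g5 i j k
  smul_mem' := by
    rintro a x ⟨h1, h2, h3, h4, h5⟩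
    refine ⟨fun i => Subalgebra.smul_mem _ (h1 i) a, fun i j => Subalgebra.smul_mem _ (h2 i j) a,
      ?_, ?_, ?_⟩
    · simp [divergence_smul, h3]
    · intro i j
      simp [h4 i j]
    · intro i j k
      have := congrArg (fun f => a • f) (h5 i j k)
      simpa [smul_add] using this

/-- Elements of degree `p` when `x_i` has degree `w i`, `∂_i` has degree `-w i`, `dx_i ∧ dx_j`
has degree `w i + w j + s`; so `d` is given the degree `s / 2`. -/
def homogeneous5 (w : Fin 5 → ℤ) (s p : ℤ) : Submodule F (Ambient5 F) where
  carrier := {x | (∀ i, IsHom w (p + w i) (x.1 i)) ∧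
    ∀ i j, IsHom w (p - w i - w j - s) (x.2 i j)}
  zero_mem' := ⟨fun i m h => absurd (by simp) h, fun i j m h => absurd (by simp) h⟩
  add_mem' := by
    rintro x y ⟨h1, h2⟩ ⟨g1, g2⟩
    constructor
    · intro i m h
      by_cases hx : coeff m (x.1 i) = 0
      · refine g1 i m fun hy => h ?_
        simp [hx, hy]
      · exact h1 i m hx
    · intro i j m h
      by_cases hx : coeff m (x.2 i j) = 0
      · refine g2 i j m fun hy => h ?_
        simp [hx, hy]
      · exact h2 i j m hx
  smul_mem' := by
    rintro a x ⟨h1, h2⟩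
    exact ⟨fun i m h => h1 i m fun hx => h (by simp [hx]),
      fun i j m h => h2 i j m fun hx => h (by simp [hx])⟩

/-- `E(3,6)`: the subalgebra of `E(5,10)` of elements of degree 0 with respect to
`deg x_1 = deg x_2 = deg x_3 = 0`, `deg x_4 = deg x_5 = 1`, `deg d = -1/2`. -/
def E36 (c : CoeffKind) : Submodule F (Ambient5 F) :=
  E510 F c ⊓ homogeneous5 F ![0, 0, 0, 1, 1] (-1) 0

theorem bracket5_mem_E510 (c : CoeffKind) : ∀ x ∈ E510 F c, ∀ y ∈ E510 F c,
    bracket5 F x y ∈ E510 F c := by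
  rintro x ⟨h1, h2, h3, h4, h5⟩ y ⟨g1, g2, g3, g4, g5⟩
  refine ⟨fun i => ?_, fun i j => ?_, ?_, ?_, ?_⟩
  · change lieVec x.1 y.1 i + formBracket x.2 y.2 i ∈ coeffRing F 5 c
    refine add_mem (lieVec_mem h1 g1 i) ?_
    exact sum_mem fun i _ => sum_mem fun j _ => sum_mem fun k _ => sum_mem fun l _ =>
      zsmul_mem (mul_mem (h2 i j) (g2 k l)) _
  · exact sub_mem (lieForm_mem h1 g2 i j) (lieForm_mem g1 h2 i j)
  · change divergence (lieVec x.1 y.1 + formBracket x.2 y.2) = 0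
    rw [divergence_add, divergence_lieVec, h3, g3, divergence_formBracket h4 h5 g4 g5]
    simp [actFun]
  · intro i j
    change lieForm x.1 y.2 j i - lieForm y.1 x.2 j i = -(lieForm x.1 y.2 i j - lieForm y.1 x.2 i j)
    rw [isSkew_lieForm x.1 g4 i j, isSkew_lieForm y.1 h4 i j]
    ring
  · intro i j k
    change pderiv F i (lieForm x.1 y.2 j k - lieForm y.1 x.2 j k)
      + pderiv F j (lieForm x.1 y.2 k i - lieForm y.1 x.2 k i)
      + pderiv F k (lieForm x.1 y.2 i j - lieForm y.1 x.2 i j) = 0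
    simp only [map_sub]
    linear_combination isClosedForm_lieForm x.1 g4 g5 i j k - isClosedForm_lieForm y.1 h4 h5 i j k

theorem bracket5_mem_homogeneous5 {w : Fin 5 → ℤ} {s : ℤ} (hw : ∑ a, w a + 2 * s = 0) (p q : ℤ) :
    ∀ x ∈ homogeneous5 F w s p, ∀ y ∈ homogeneous5 F w s q,
      bracket5 F x y ∈ homogeneous5 F w s (p + q) := by
  rintro x ⟨h1, h2⟩ y ⟨g1, g2⟩
  refine ⟨fun t => ?_, fun i j => ?_⟩
  · change IsHom w _ (actFun x.1 (y.1 t) - actFun y.1 (x.1 t) + formBracket x.2 y.2 t)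
    refine IsHom.add (IsHom.sub ?_ ?_) ?_
    · exact IsHom.actFun h1 (g1 t) (by ring)
    · exact IsHom.actFun g1 (h1 t) (by ring)
    · refine IsHom.sum _ fun i _ => IsHom.sum _ fun j _ => IsHom.sum _ fun k _ =>
        IsHom.sum _ fun l _ => ?_
      by_cases he : eps5 t i j k l = 0
      · rw [he, zero_smul]
        exact IsHom.zero _ _
      · refine ((h2 i j).mul (g2 k l) ?_).zsmul _
        linear_combination -hw - eps5_degree he w
  · change IsHom w _ (lieForm x.1 y.2 i j - lieForm y.1 x.2 i j)
    refine IsHom.sub ?_ ?_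
    · refine IsHom.add (IsHom.actFun h1 (g2 i j) (by ring)) (IsHom.sum _ fun k _ => IsHom.add ?_ ?_)
      · exact ((h1 k).pderiv i).mul (g2 k j) (by ring)
      · exact ((h1 k).pderiv j).mul (g2 i k) (by ring)
    · refine IsHom.add (IsHom.actFun g1 (h2 i j) (by ring)) (IsHom.sum _ fun k _ => IsHom.add ?_ ?_)
      · exact ((g1 k).pderiv i).mul (h2 k j) (by ring)
      · exact ((g1 k).pderiv j).mul (h2 i k) (by ring)

theorem bracket5_mem_E36 (c : CoeffKind) : ∀ x ∈ E36 F c, ∀ y ∈ E36 F c,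
    bracket5 F x y ∈ E36 F c := by
  rintro x ⟨h1, h2⟩ y ⟨g1, g2⟩
  refine ⟨bracket5_mem_E510 F c x h1 y g1, ?_⟩
  have := bracket5_mem_homogeneous5 F (w := ![0, 0, 0, 1, 1]) (s := -1)
    (by simp [Fin.sum_univ_five]) 0 0 x h2 y g2
  simpa using this

/-- The bracket of `E(5,10)`. -/
def bracketE510 (c : CoeffKind) : E510 F c →ₗ[F] E510 F c →ₗ[F] E510 F c :=
  restrictBracket (bracket5 F) (E510 F c) (bracket5_mem_E510 F c)

/-- The bracket of `E(3,6)`. -/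
def bracketE36 (c : CoeffKind) : E36 F c →ₗ[F] E36 F c →ₗ[F] E36 F c :=
  restrictBracket (bracket5 F) (E36 F c) (bracket5_mem_E36 F c)

/-- The `ℤ`-grading of `E(5,10)`: `deg x_i = 2`, `deg d = -5/2`, `deg dx_i = -1/2`. -/
def gradeE510 (c : CoeffKind) (p : ℤ) : Submodule F (E510 F c) :=
  (homogeneous5 F (fun _ => 2) (-5) p).comap (E510 F c).subtype

/-- The `ℤ`-grading of `E(3,6)`, induced by that of `E(5,10)`. -/
def gradeE36 (c : CoeffKind) (p : ℤ) : Submodule F (E36 F c) :=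
  (homogeneous5 F (fun _ => 2) (-5) p).comap (E36 F c).subtype

end E510
/-! ### E(3,8)

The even part is `W_3 ⊕ Ω⁰ ⊗ 𝔰𝔩(2) ⊕ dΩ¹`, the odd part is `Ω⁰ ⊗ F² ⊕ Ω² ⊗ F²` with `Ω⁰` and `Ω²`
twisted by `-1/2` times the divergence (all in three variables). -/

section E38

variable {F : Type*} [Field F]

/-- The identification of 2-forms with vector fields in three variables by the volume form:
`dx_2 ∧ dx_3 ↦ ∂_1`, `dx_3 ∧ dx_1 ↦ ∂_2`, `dx_1 ∧ dx_2 ↦ ∂_3`. In particular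
`divergence (starVec σ)` and `actFun (starVec σ) f` are the coefficients of the 3-forms `dσ` and
`df ∧ σ`. -/
def starVec (σ : Fin 3 → Fin 3 → MvPowerSeries (Fin 3) F) : Fin 3 → MvPowerSeries (Fin 3) F :=
  fun k => σ (k + 1) (k + 2)

/-- The cross product of vector fields, as a 1-form. -/
def crossForm (X Y : Fin 3 → MvPowerSeries (Fin 3) F) : Fin 3 → MvPowerSeries (Fin 3) F :=
  fun k => X (k + 1) * Y (k + 2) - X (k + 2) * Y (k + 1)

variable (F) in
/-- A vector field, a `2 × 2` matrix of functions, a 2-form. -/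
abbrev Even3 : Type _ :=
  (Fin 3 → MvPowerSeries (Fin 3) F) × Matrix (Fin 2) (Fin 2) (MvPowerSeries (Fin 3) F) ×
    (Fin 3 → Fin 3 → MvPowerSeries (Fin 3) F)

variable (F) in
/-- A pair of functions and a pair of 2-forms, that is, `∑ h_a ⊗ e_a` and `∑ S_a ⊗ e_a` for the
standard basis `e_0, e_1` of `F²`. -/
abbrev Odd3 : Type _ :=
  (Fin 2 → MvPowerSeries (Fin 3) F) × (Fin 2 → Fin 3 → Fin 3 → MvPowerSeries (Fin 3) F)

/-- `[X, Y] = XY - YX - ½ d(div X) ∧ d(div Y)`, `[X, f ⊗ A] = X(f) ⊗ A`, `[X, ω] = L_X ω`,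
`[f ⊗ A, g ⊗ B] = fg ⊗ [A, B] + tr(AB) df ∧ dg`, `[f ⊗ A, ω] = 0`, `[ω, ω'] = 0`. -/
def evenEven3 (x y : Even3 F) : Even3 F :=
  (lieVec x.1 y.1,
   Matrix.of fun a b => actFun x.1 (y.2.1 a b) - actFun y.1 (x.2.1 a b)
     + (x.2.1 * y.2.1 - y.2.1 * x.2.1) a b,
   fun i j => lieForm x.1 y.2.2 i j - lieForm y.1 x.2.2 i j
     - (2⁻¹ : F) • dWedge (divergence x.1) (divergence y.1) i j
     + ∑ a, ∑ b, dWedge (x.2.1 a b) (y.2.1 b a) i j)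

/-- `[X, h ⊗ v] = (X(h) - ½ (div X) h + ½ d(div X) ∧ dh) ⊗ v`,
`[X, σ ⊗ v] = (L_X σ - ½ (div X) σ) ⊗ v`, `[f ⊗ A, h ⊗ v] = (fh + df ∧ dh) ⊗ Av`,
`[f ⊗ A, σ ⊗ v] = fσ ⊗ Av`, `[ω, h ⊗ v] = hω ⊗ v`, `[ω, σ ⊗ v] = 0`. -/
def evenOdd3 (x : Even3 F) (y : Odd3 F) : Odd3 F :=
  (fun a => actFun x.1 (y.1 a) - (2⁻¹ : F) • (divergence x.1 * y.1 a) + ∑ b, x.2.1 a b * y.1 b,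
   fun a i j => lieForm x.1 (y.2 a) i j - (2⁻¹ : F) • (divergence x.1 * y.2 a i j)
     + (2⁻¹ : F) • dWedge (divergence x.1) (y.1 a) i j
     + ∑ b, (x.2.1 a b * y.2 b i j + dWedge (x.2.1 a b) (y.1 b) i j)
     + y.1 a * x.2.2 i j)

/-- The coefficient of `e_a · e_b` in the `𝔰𝔩(2)`-part of `[h, S]`: half the coefficient of
`dh_a ∧ S_b - h_a dS_b`. -/
def symCoeff (h : Fin 2 → MvPowerSeries (Fin 3) F)
    (S : Fin 2 → Fin 3 → Fin 3 → MvPowerSeries (Fin 3) F) :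
    Matrix (Fin 2) (Fin 2) (MvPowerSeries (Fin 3) F) :=
  Matrix.of fun a b => (2⁻¹ : F) •
    (actFun (starVec (S b)) (h a) - h a * divergence (starVec (S b)))

/-- The matrix of `∑ φ_ab e_a · e_b`, where `(u · v) w = det (u, w) v + det (v, w) u`. -/
def symToSl2 (φ : Matrix (Fin 2) (Fin 2) (MvPowerSeries (Fin 3) F)) :
    Matrix (Fin 2) (Fin 2) (MvPowerSeries (Fin 3) F) :=
  !![-(φ 0 1 + φ 1 0), φ 0 0 + φ 0 0; -(φ 1 1 + φ 1 1), φ 0 1 + φ 1 0]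

/-- With `u ∧ v = det (u, v)`, `(u · v) w = (u ∧ w) v + (v ∧ w) u`, and 2-forms identified with
vector fields where a vector field is expected:
`[h ⊗ u, g ⊗ v] = (u ∧ v) dh ∧ dg`,
`[h ⊗ u, σ ⊗ v] = (u ∧ v) (hσ - d(dσ) ∧ dh) + ½ (dh ∧ σ - h dσ) ⊗ (u · v)`,
`[σ ⊗ u, τ ⊗ v] = - (u ∧ v) d(σ × τ)`. -/
def oddOdd3 (x y : Odd3 F) : Even3 F :=
  (fun k => starVec (dWedge (x.1 0) (y.1 1)) k - starVec (dWedge (x.1 1) (y.1 0)) k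
     + (x.1 0 * starVec (y.2 1) k - x.1 1 * starVec (y.2 0) k)
     + (y.1 0 * starVec (x.2 1) k - y.1 1 * starVec (x.2 0) k),
   symToSl2 (symCoeff x.1 y.2 + symCoeff y.1 x.2),
   fun i j =>
     -(dWedge (divergence (starVec (y.2 1))) (x.1 0) i j
         - dWedge (divergence (starVec (y.2 0))) (x.1 1) i j)
     - (dWedge (divergence (starVec (x.2 1))) (y.1 0) i j
         - dWedge (divergence (starVec (x.2 0))) (y.1 1) i j)
     - dOne (crossForm (starVec (x.2 0)) (starVec (y.2 1))
         - crossForm (starVec (x.2 1)) (starVec (y.2 0))) i j)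

theorem starVec_add (σ τ : Fin 3 → Fin 3 → MvPowerSeries (Fin 3) F) :
    starVec (σ + τ) = starVec σ + starVec τ := rfl

theorem starVec_smul (c : F) (σ : Fin 3 → Fin 3 → MvPowerSeries (Fin 3) F) :
    starVec (c • σ) = c • starVec σ := rfl

theorem crossForm_add_left (X Y Z : Fin 3 → MvPowerSeries (Fin 3) F) :
    crossForm (X + Y) Z = crossForm X Z + crossForm Y Z := by
  ext1 k; simp only [crossForm, Pi.add_apply]; ring

theorem crossForm_add_right (X Y Z : Fin 3 → MvPowerSeries (Fin 3) F) :
    crossForm X (Y + Z) = crossForm X Y + crossForm X Z := by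
  ext1 k; simp only [crossForm, Pi.add_apply]; ring

theorem crossForm_smul_left (c : F) (X Y : Fin 3 → MvPowerSeries (Fin 3) F) :
    crossForm (c • X) Y = c • crossForm X Y := by
  ext1 k; simp [crossForm, smul_sub]

theorem crossForm_smul_right (c : F) (X Y : Fin 3 → MvPowerSeries (Fin 3) F) :
    crossForm X (c • Y) = c • crossForm X Y := by
  ext1 k; simp [crossForm, smul_sub]

/-- `evenEven3` as a bilinear map. -/
def evenEven3ₗ : Even3 F →ₗ[F] Even3 F →ₗ[F] Even3 F :=
  LinearMap.mk₂ F evenEven3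
    (by
      intro x y z
      refine Prod.ext ?_ (Prod.ext ?_ ?_)
      · exact lieVecₗ.map_add₂ x.1 y.1 z.1
      · ext1 a b
        simp [evenEven3, actFun_add_left, actFun_add_right, add_mul, mul_add]
        ring
      · funext i j
        simp [evenEven3, lieForm_add_left, lieForm_add_right, divergence_add, dWedge_add_left,
          Finset.sum_add_distrib]
        ring)
    (by
      intro c x z
      refine Prod.ext ?_ (Prod.ext ?_ ?_)
      · exact lieVecₗ.map_smul₂ c x.1 z.1
      · ext1 a b
        simp [evenEven3, actFun_smul_left, actFun_smul_right]
        simp only [Algebra.smul_def]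
        ring
      · funext i j
        simp [evenEven3, lieForm_smul_left, lieForm_smul_right, divergence_smul, dWedge_smul_left]
        simp only [Algebra.smul_def]
        ring)
    (by
      intro x y z
      refine Prod.ext ?_ (Prod.ext ?_ ?_)
      · exact map_add (lieVecₗ x.1) y.1 z.1
      · ext1 a b
        simp [evenEven3, actFun_add_left, actFun_add_right, add_mul, mul_add]
        ring
      · funext i j
        simp [evenEven3, lieForm_add_left, lieForm_add_right, divergence_add, dWedge_add_right,
          Finset.sum_add_distrib]
        ring)
    (by
      intro c x z
      refine Prod.ext ?_ (Prod.ext ?_ ?_)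
      · exact map_smul (lieVecₗ x.1) c z.1
      · ext1 a b
        simp [evenEven3, actFun_smul_left, actFun_smul_right]
        simp only [Algebra.smul_def]
        ring
      · funext i j
        simp [evenEven3, lieForm_smul_left, lieForm_smul_right, divergence_smul, dWedge_smul_right]
        simp only [Algebra.smul_def]
        ring)

/-- `evenOdd3` as a bilinear map. -/
def evenOdd3ₗ : Even3 F →ₗ[F] Odd3 F →ₗ[F] Odd3 F :=
  LinearMap.mk₂ F evenOdd3
    (by
      intro x y z
      refine Prod.ext ?_ ?_
      · funext a
        simp [evenOdd3, actFun_add_left, divergence_add, add_mul]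
        simp only [Algebra.smul_def]
        ring
      · funext a i j
        simp [evenOdd3, lieForm_add_left, divergence_add, dWedge_add_left, add_mul, mul_add]
        simp only [Algebra.smul_def]
        ring)
    (by
      intro c x z
      refine Prod.ext ?_ ?_
      · funext a
        simp [evenOdd3, actFun_smul_left, divergence_smul]
        simp only [Algebra.smul_def]
        ring
      · funext a i j
        simp [evenOdd3, lieForm_smul_left, divergence_smul, dWedge_smul_left]
        simp only [Algebra.smul_def]
        ring)
    (by
      intro x y z
      refine Prod.ext ?_ ?_
      · funext a
        simp [evenOdd3, actFun_add_right, mul_add]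
        simp only [Algebra.smul_def]
        ring
      · funext a i j
        simp [evenOdd3, lieForm_add_right, dWedge_add_right, add_mul, mul_add]
        simp only [Algebra.smul_def]
        ring)
    (by
      intro c x z
      refine Prod.ext ?_ ?_
      · funext a
        simp [evenOdd3, actFun_smul_right]
        simp only [Algebra.smul_def]
        ring
      · funext a i j
        simp [evenOdd3, lieForm_smul_right, dWedge_smul_right]
        simp only [Algebra.smul_def]
        ring)

theorem symCoeff_add_left (h g : Fin 2 → MvPowerSeries (Fin 3) F)
    (S : Fin 2 → Fin 3 → Fin 3 → MvPowerSeries (Fin 3) F) :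
    symCoeff (h + g) S = symCoeff h S + symCoeff g S := by
  ext1 a b
  simp [symCoeff, actFun_add_right, add_mul]
  simp only [Algebra.smul_def]
  ring

theorem symCoeff_add_right (h : Fin 2 → MvPowerSeries (Fin 3) F)
    (S T : Fin 2 → Fin 3 → Fin 3 → MvPowerSeries (Fin 3) F) :
    symCoeff h (S + T) = symCoeff h S + symCoeff h T := by
  ext1 a b
  simp [symCoeff, starVec_add, actFun_add_left, divergence_add, mul_add]
  simp only [Algebra.smul_def]
  ring

theorem symCoeff_smul_left (c : F) (h : Fin 2 → MvPowerSeries (Fin 3) F)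
    (S : Fin 2 → Fin 3 → Fin 3 → MvPowerSeries (Fin 3) F) :
    symCoeff (c • h) S = c • symCoeff h S := by
  ext1 a b
  simp [symCoeff, actFun_smul_right]
  simp only [Algebra.smul_def]
  ring

theorem symCoeff_smul_right (c : F) (h : Fin 2 → MvPowerSeries (Fin 3) F)
    (S : Fin 2 → Fin 3 → Fin 3 → MvPowerSeries (Fin 3) F) :
    symCoeff h (c • S) = c • symCoeff h S := by
  ext1 a b
  simp [symCoeff, starVec_smul, actFun_smul_left, divergence_smul]
  simp only [Algebra.smul_def]
  ring

theorem oddOdd3_comm (x y : Odd3 F) : oddOdd3 x y = oddOdd3 y x := by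
  refine Prod.ext ?_ (Prod.ext ?_ ?_)
  · funext k
    simp only [oddOdd3, starVec, dWedge]
    ring
  · simp only [oddOdd3]
    rw [add_comm]
  · funext i j
    simp only [oddOdd3, dOne, crossForm, Pi.sub_apply, map_sub, Derivation.leibniz, smul_eq_mul]
    ring

theorem oddOdd3_add (x y z : Odd3 F) : oddOdd3 (x + y) z = oddOdd3 x z + oddOdd3 y z := by
  refine Prod.ext ?_ (Prod.ext ?_ ?_)
  · funext k
    simp [oddOdd3, starVec, dWedge_add_left, add_mul, mul_add]
    ring
  · ext1 a b
    fin_cases a <;> fin_cases b <;>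
      simp [oddOdd3, symToSl2, symCoeff_add_left, symCoeff_add_right] <;> ring
  · funext i j
    simp [oddOdd3, starVec_add, divergence_add, dWedge_add_left, dWedge_add_right,
      crossForm_add_left, dOne]
    ring

theorem oddOdd3_smul (c : F) (x z : Odd3 F) : oddOdd3 (c • x) z = c • oddOdd3 x z := by
  refine Prod.ext ?_ (Prod.ext ?_ ?_)
  · funext k
    simp [oddOdd3, starVec, dWedge_smul_left]
    simp only [Algebra.smul_def]
    ring
  · ext1 a b
    fin_cases a <;> fin_cases b <;>
      simp [oddOdd3, symToSl2, symCoeff_smul_left, symCoeff_smul_right]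
  · funext i j
    simp [oddOdd3, starVec_smul, divergence_smul, dWedge_smul_left, dWedge_smul_right,
      crossForm_smul_left, dOne]
    simp only [Algebra.smul_def]
    ring

/-- `oddOdd3` as a bilinear map. -/
def oddOdd3ₗ : Odd3 F →ₗ[F] Odd3 F →ₗ[F] Even3 F :=
  LinearMap.mk₂ F oddOdd3 oddOdd3_add oddOdd3_smul
    (by intro x y z; rw [oddOdd3_comm, oddOdd3_add, oddOdd3_comm y, oddOdd3_comm z])
    (by intro c x y; rw [oddOdd3_comm, oddOdd3_smul, oddOdd3_comm])

variable (F)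

/-- The product on `Even3 × Odd3`. -/
def bracket3 : (Even3 F × Odd3 F) →ₗ[F] (Even3 F × Odd3 F) →ₗ[F] (Even3 F × Odd3 F) :=
  superBracket evenEven3ₗ evenOdd3ₗ oddOdd3ₗ

/-- `E(3,8)`: the matrix is traceless and the even 2-form is closed. -/
def E38 (c : CoeffKind) : Submodule F (Even3 F × Odd3 F) where
  carrier := {x | ((∀ i, x.1.1 i ∈ coeffRing F 3 c) ∧ (∀ a b, x.1.2.1 a b ∈ coeffRing F 3 c) ∧
      (∀ i j, x.1.2.2 i j ∈ coeffRing F 3 c) ∧ (∀ a, x.2.1 a ∈ coeffRing F 3 c) ∧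
      ∀ a i j, x.2.2 a i j ∈ coeffRing F 3 c) ∧
    x.1.2.1 0 0 + x.1.2.1 1 1 = 0 ∧ IsSkew x.1.2.2 ∧ IsClosedForm x.1.2.2 ∧
    ∀ a, IsSkew (x.2.2 a)}
  zero_mem' := by
    refine ⟨⟨fun i => zero_mem _, fun a b => zero_mem _, fun i j => zero_mem _,
      fun a => zero_mem _, fun a i j => zero_mem _⟩, ?_, ?_, ?_, ?_⟩
    · simp
    · intro i j; simp
    · intro i j k; simp
    · intro a i j; simp
  add_mem' := by
    rintro x y ⟨⟨h1, h2, h3, h4, h5⟩, h6, h7, h8, h9⟩ ⟨⟨g1, g2, g3, g4, g5⟩, g6, g7, g8, g9⟩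
    refine ⟨⟨fun i => add_mem (h1 i) (g1 i), fun a b => add_mem (h2 a b) (g2 a b),
      fun i j => add_mem (h3 i j) (g3 i j), fun a => add_mem (h4 a) (g4 a),
      fun a i j => add_mem (h5 a i j) (g5 a i j)⟩, ?_, ?_, ?_, ?_⟩
    · change x.1.2.1 0 0 + y.1.2.1 0 0 + (x.1.2.1 1 1 + y.1.2.1 1 1) = 0
      linear_combination h6 + g6
    · intro i j
      change x.1.2.2 j i + y.1.2.2 j i = -(x.1.2.2 i j + y.1.2.2 i j)
      rw [h7 i j, g7 i j]; ring
    · intro i j k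
      simp only [Prod.fst_add, Prod.snd_add, Pi.add_apply, map_add]
      linear_combination h8 i j k + g8 i j k
    · intro a i j
      change x.2.2 a j i + y.2.2 a j i = -(x.2.2 a i j + y.2.2 a i j)
      rw [h9 a i j, g9 a i j]; ring
  smul_mem' := by
    rintro r x ⟨⟨h1, h2, h3, h4, h5⟩, h6, h7, h8, h9⟩
    refine ⟨⟨fun i => Subalgebra.smul_mem _ (h1 i) r, fun a b => Subalgebra.smul_mem _ (h2 a b) r,
      fun i j => Subalgebra.smul_mem _ (h3 i j) r, fun a => Subalgebra.smul_mem _ (h4 a) r,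
      fun a i j => Subalgebra.smul_mem _ (h5 a i j) r⟩, ?_, ?_, ?_, ?_⟩
    · change r • x.1.2.1 0 0 + r • x.1.2.1 1 1 = 0
      rw [← smul_add, h6, smul_zero]
    · intro i j
      change r • x.1.2.2 j i = -(r • x.1.2.2 i j)
      rw [h7 i j, smul_neg]
    · intro i j k
      have := congrArg (fun f => r • f) (h8 i j k)
      simpa [smul_add] using this
    · intro a i j
      change r • x.2.2 a j i = -(r • x.2.2 a i j)
      rw [h9 a i j, smul_neg]

variable {F}

theorem starVec_mem {c : CoeffKind} {σ : Fin 3 → Fin 3 → MvPowerSeries (Fin 3) F}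
    (h : ∀ i j, σ i j ∈ coeffRing F 3 c) (k : Fin 3) : starVec σ k ∈ coeffRing F 3 c :=
  h _ _

theorem crossForm_mem {c : CoeffKind} {X Y : Fin 3 → MvPowerSeries (Fin 3) F}
    (hX : ∀ i, X i ∈ coeffRing F 3 c) (hY : ∀ i, Y i ∈ coeffRing F 3 c) (k : Fin 3) :
    crossForm X Y k ∈ coeffRing F 3 c :=
  sub_mem (mul_mem (hX _) (hY _)) (mul_mem (hX _) (hY _))

theorem symCoeff_mem {c : CoeffKind} {h : Fin 2 → MvPowerSeries (Fin 3) F}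
    {S : Fin 2 → Fin 3 → Fin 3 → MvPowerSeries (Fin 3) F} (hh : ∀ a, h a ∈ coeffRing F 3 c)
    (hS : ∀ a i j, S a i j ∈ coeffRing F 3 c) (a b : Fin 2) :
    symCoeff h S a b ∈ coeffRing F 3 c :=
  Subalgebra.smul_mem _ (sub_mem (actFun_mem (starVec_mem (hS b)) (hh a))
    (mul_mem (hh a) (divergence_mem (starVec_mem (hS b))))) _

variable (F)

theorem bracket3_mem_E38 (c : CoeffKind) : ∀ x ∈ E38 F c, ∀ y ∈ E38 F c,
    bracket3 F x y ∈ E38 F c := by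
  rintro x ⟨⟨h1, h2, h3, h4, h5⟩, h6, h7, h8, h9⟩ y ⟨⟨g1, g2, g3, g4, g5⟩, g6, g7, g8, g9⟩
  have hdx := divergence_mem h1
  have hdy := divergence_mem g1
  have hsx := fun a => divergence_mem (starVec_mem (h5 a))
  have hsy := fun a => divergence_mem (starVec_mem (g5 a))
  have eo : ∀ (u : Even3 F) (v : Odd3 F), (∀ i, u.1 i ∈ coeffRing F 3 c) →
      (∀ a b, u.2.1 a b ∈ coeffRing F 3 c) → (∀ i j, u.2.2 i j ∈ coeffRing F 3 c) →
      (∀ a, v.1 a ∈ coeffRing F 3 c) → (∀ a i j, v.2 a i j ∈ coeffRing F 3 c) →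
      IsSkew u.2.2 → (∀ a, IsSkew (v.2 a)) →
      (∀ a, (evenOdd3 u v).1 a ∈ coeffRing F 3 c) ∧
      (∀ a i j, (evenOdd3 u v).2 a i j ∈ coeffRing F 3 c) ∧
      ∀ a, IsSkew ((evenOdd3 u v).2 a) := by
    intro u v k1 k2 k3 k4 k5 k6 k7
    have kd := divergence_mem k1
    refine ⟨fun a => ?_, fun a i j => ?_, fun a i j => ?_⟩
    · exact add_mem (sub_mem (actFun_mem k1 (k4 a)) (Subalgebra.smul_mem _ (mul_mem kd (k4 a)) _))
        (sum_mem fun b _ => mul_mem (k2 a b) (k4 b))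
    · exact add_mem (add_mem (add_mem (sub_mem (lieForm_mem k1 (k5 a) i j)
        (Subalgebra.smul_mem _ (mul_mem kd (k5 a i j)) _))
        (Subalgebra.smul_mem _ (dWedge_mem kd (k4 a) i j) _))
        (sum_mem fun b _ => add_mem (mul_mem (k2 a b) (k5 b i j)) (dWedge_mem (k2 a b) (k4 b) i j)))
        (mul_mem (k4 a) (k3 i j))
    · simp only [evenOdd3]
      simp only [isSkew_lieForm u.1 (k7 a) i j, k7 _ i j, k6 i j, isSkew_dWedge _ _ i j,
        Fin.sum_univ_two]
      simp only [Algebra.smul_def]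
      ring
  have A := eo x.1 y.2 h1 h2 h3 g4 g5 h7 g9
  have B := eo y.1 x.2 g1 g2 g3 h4 h5 g7 h9
  have hM : (bracket3 F x y).1.2.1 = (evenEven3 x.1 y.1).2.1 + (oddOdd3 x.2 y.2).2.1 := rfl
  have hW : (bracket3 F x y).1.2.2 = (evenEven3 x.1 y.1).2.2 + (oddOdd3 x.2 y.2).2.2 := rfl
  refine ⟨⟨fun i => ?_, fun a b => ?_, fun i j => ?_, fun a => sub_mem (A.1 a) (B.1 a),
    fun a i j => sub_mem (A.2.1 a i j) (B.2.1 a i j)⟩, ?_, ?_, ?_, ?_⟩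
  · change lieVec x.1.1 y.1.1 i + (oddOdd3 x.2 y.2).1 i ∈ coeffRing F 3 c
    refine add_mem (lieVec_mem h1 g1 i) (add_mem (add_mem (sub_mem ?_ ?_) (sub_mem ?_ ?_))
      (sub_mem ?_ ?_))
    · exact dWedge_mem (h4 0) (g4 1) _ _
    · exact dWedge_mem (h4 1) (g4 0) _ _
    · exact mul_mem (h4 0) (g5 1 _ _)
    · exact mul_mem (h4 1) (g5 0 _ _)
    · exact mul_mem (g4 0) (h5 1 _ _)
    · exact mul_mem (g4 1) (h5 0 _ _)
  · rw [hM]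
    refine add_mem ?_ ?_
    · simp only [evenEven3, Matrix.of_apply, Matrix.sub_apply, Matrix.mul_apply]
      exact add_mem (sub_mem (actFun_mem h1 (g2 a b)) (actFun_mem g1 (h2 a b)))
        (sub_mem (sum_mem fun k _ => mul_mem (h2 a k) (g2 k b))
          (sum_mem fun k _ => mul_mem (g2 a k) (h2 k b)))
    · have hN : ∀ a b, (symCoeff x.2.1 y.2.2 + symCoeff y.2.1 x.2.2) a b ∈ coeffRing F 3 c :=
        fun a b => add_mem (symCoeff_mem h4 g5 a b) (symCoeff_mem g4 h5 a b)
      fin_cases a <;> fin_cases b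
      · exact neg_mem (add_mem (hN 0 1) (hN 1 0))
      · exact add_mem (hN 0 0) (hN 0 0)
      · exact neg_mem (add_mem (hN 1 1) (hN 1 1))
      · exact add_mem (hN 0 1) (hN 1 0)
  · rw [hW]
    refine add_mem ?_ (sub_mem (sub_mem (neg_mem (sub_mem ?_ ?_)) (sub_mem ?_ ?_)) ?_)
    · exact add_mem (sub_mem (sub_mem (lieForm_mem h1 g3 i j) (lieForm_mem g1 h3 i j))
        (Subalgebra.smul_mem _ (dWedge_mem hdx hdy i j) _))
        (sum_mem fun a _ => sum_mem fun b _ => dWedge_mem (h2 a b) (g2 b a) i j)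
    · exact dWedge_mem (hsy 1) (h4 0) i j
    · exact dWedge_mem (hsy 0) (h4 1) i j
    · exact dWedge_mem (hsx 1) (g4 0) i j
    · exact dWedge_mem (hsx 0) (g4 1) i j
    · exact dOne_mem (fun k => sub_mem
        (crossForm_mem (starVec_mem (h5 0)) (starVec_mem (g5 1)) k)
        (crossForm_mem (starVec_mem (h5 1)) (starVec_mem (g5 0)) k)) i j
  · rw [hM]
    have e0 : ∀ φ : Matrix (Fin 2) (Fin 2) (MvPowerSeries (Fin 3) F),
        symToSl2 φ 0 0 + symToSl2 φ 1 1 = 0 := by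
      intro φ
      simp [symToSl2]
    have e3 := e0 (symCoeff x.2.1 y.2.2 + symCoeff y.2.1 x.2.2)
    rw [Matrix.add_apply, Matrix.add_apply]
    simp only [oddOdd3, evenEven3, Matrix.of_apply, Matrix.sub_apply, Matrix.mul_apply,
      Fin.sum_univ_two]
    have e1 : actFun x.1.1 (y.1.2.1 0 0) + actFun x.1.1 (y.1.2.1 1 1) = 0 := by
      rw [← actFun_add_right, g6]; simp [actFun]
    have e2 : actFun y.1.1 (x.1.2.1 0 0) + actFun y.1.1 (x.1.2.1 1 1) = 0 := by
      rw [← actFun_add_right, h6]; simp [actFun]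
    linear_combination e1 - e2 + e3
  · intro i j
    rw [hW]
    simp only [Pi.add_apply, oddOdd3, evenEven3, isSkew_lieForm x.1.1 g7 i j,
      isSkew_lieForm y.1.1 h7 i j, isSkew_dWedge _ _ i j, isSkew_dOne _ i j, Fin.sum_univ_two]
    simp only [Algebra.smul_def]
    ring
  · intro i j k
    rw [hW]
    simp only [Pi.add_apply, oddOdd3, evenEven3, Fin.sum_univ_two, map_add, map_sub, map_neg,
      Derivation.map_smul]
    simp only [Algebra.smul_def]
    linear_combination isClosedForm_lieForm x.1.1 g7 g8 i j k
      - isClosedForm_lieForm y.1.1 h7 h8 i j k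
      - algebraMap F _ 2⁻¹ * isClosedForm_dWedge (divergence x.1.1) (divergence y.1.1) i j k
      + isClosedForm_dWedge (x.1.2.1 0 0) (y.1.2.1 0 0) i j k
      + isClosedForm_dWedge (x.1.2.1 0 1) (y.1.2.1 1 0) i j k
      + isClosedForm_dWedge (x.1.2.1 1 0) (y.1.2.1 0 1) i j k
      + isClosedForm_dWedge (x.1.2.1 1 1) (y.1.2.1 1 1) i j k
      - isClosedForm_dWedge (divergence (starVec (y.2.2 1))) (x.2.1 0) i j k
      + isClosedForm_dWedge (divergence (starVec (y.2.2 0))) (x.2.1 1) i j k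
      - isClosedForm_dWedge (divergence (starVec (x.2.2 1))) (y.2.1 0) i j k
      + isClosedForm_dWedge (divergence (starVec (x.2.2 0))) (y.2.1 1) i j k
      - isClosedForm_dOne (crossForm (starVec (x.2.2 0)) (starVec (y.2.2 1))
         - crossForm (starVec (x.2.2 1)) (starVec (y.2.2 0))) i j k
  · intro a i j
    change (evenOdd3 x.1 y.2).2 a j i - (evenOdd3 y.1 x.2).2 a j i =
      -((evenOdd3 x.1 y.2).2 a i j - (evenOdd3 y.1 x.2).2 a i j)
    rw [A.2.2 a i j, B.2.2 a i j]
    ring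

/-- The bracket of `E(3,8)`. -/
def bracketE38 (c : CoeffKind) : E38 F c →ₗ[F] E38 F c →ₗ[F] E38 F c :=
  restrictBracket (bracket3 F) (E38 F c) (bracket3_mem_E38 F c)

/-- The `ℤ`-grading of `E(3,8)`: `deg x_i = -deg ∂_i = deg dx_i = 2`, `deg e_a = -3`, and
`𝔰𝔩(2)` has degree `0`. -/
def gradeE38 (c : CoeffKind) (p : ℤ) : Submodule F (E38 F c) where
  carrier := {x | (∀ i, IsHom (fun _ => 2) (p + 2) (x.1.1.1 i)) ∧
    (∀ a b, IsHom (fun _ => 2) p (x.1.1.2.1 a b)) ∧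
    (∀ i j, IsHom (fun _ => 2) (p - 4) (x.1.1.2.2 i j)) ∧
    (∀ a, IsHom (fun _ => 2) (p + 3) (x.1.2.1 a)) ∧
    ∀ a i j, IsHom (fun _ => 2) (p - 1) (x.1.2.2 a i j)}
  zero_mem' := ⟨fun _ => IsHom.zero _ _, fun _ _ => IsHom.zero _ _, fun _ _ => IsHom.zero _ _,
    fun _ => IsHom.zero _ _, fun _ _ _ => IsHom.zero _ _⟩
  add_mem' := by
    rintro x y ⟨h1, h2, h3, h4, h5⟩ ⟨g1, g2, g3, g4, g5⟩
    exact ⟨fun i => (h1 i).add (g1 i), fun a b => (h2 a b).add (g2 a b),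
      fun i j => (h3 i j).add (g3 i j), fun a => (h4 a).add (g4 a),
      fun a i j => (h5 a i j).add (g5 a i j)⟩
  smul_mem' := by
    rintro r x ⟨h1, h2, h3, h4, h5⟩
    exact ⟨fun i => (h1 i).smul r, fun a b => (h2 a b).smul r, fun i j => (h3 i j).smul r,
      fun a => (h4 a).smul r, fun a i j => (h5 a i j).smul r⟩

end E38

end ExcLie

end

open ExcLie

open MvPowerSeries

noncomputable section

namespace ExcLie

/-! ### Rigidity from commuting inner derivations -/

section Rigidity

variable {F V ι : Type*} [Field F] [AddCommGroup V] [Module F V]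
  {parity : ZMod 2 → Submodule F V} {br : V →ₗ[F] V →ₗ[F] V} {σ : V →ₗ[F] V}

/-! The map `σ` turns out to be the identity on the whole algebra; the pieces of degree -1 and 0 are
then special cases. The argument compares `σ` with the commuting derivations `D i = ad ∂_i`, for all
five coordinates in E(5,10) and for the three coordinates x_1, x_2, x_3 in E(3,6) and E(3,8).

For commuting even x, y the Hom-Jacobi identity collapses to [σx,[y,z]] = [σy,[x,z]]
(`bracket_map_comm`). If ∂_i kills z, then σ∂_i commutes with [∂_j,z]. There are enough such z, of
low degree, to force σ∂_i = a_i ∂_i. An element on which ∂_i∂_j does not vanish then gives a_i =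
a_j, so there is a single scalar a.

Once σ∂_m = a∂_m, subtracting a times the ordinary Jacobi identity for ∂_m from the Hom-Jacobi
identity leaves [(σ-a)y, ∂_m z] = ±[(σ-a)z, ∂_m y] (`bracket_sub_smul_comm`). For y killed by ∂_m
the right side vanishes, so (σ-a)y centralizes the image of ∂_m and is zero. For arbitrary y,
letting z run over elements killed by some ∂_m makes the right side vanish again, so (σ-a)y
centralizes all ∂_i z of this kind. These still have trivial centralizer, whence σ = a.
Multiplicativity on one nonzero bracket gives a = a², and σ ≠ 0 leaves a = 1.

This is `IsHomLieStructure.eq_id`, and it uses the Jacobi identity of the algebra only for the ∂_i.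
What depends on the algebra is a pair of centralizer computations: `exists_smul_coordinate` and
`eq_zero_of_bracket` for E(5,10) and E(3,6) together, `exists_smul_coordinateE38` and
`eq_zero_of_bracketE38` for E(3,8). In each, the brackets with ∂_k show that an element has constant
coefficients, and linear or quadratic test elements then kill those constants one by one. -/

theorem IsHomLieStructure.skew_even (h : IsHomLieStructure parity br σ) {x y : V} {k : ZMod 2}
    (hx : x ∈ parity 0) (hy : y ∈ parity k) : br x y = -br y x := by
  simpa using h.skew 0 k x hx y hy

theorem IsHomLieStructure.bracket_eq_zero_comm (h : IsHomLieStructure parity br σ) {x y : V}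
    {j k : ZMod 2} (hx : x ∈ parity j) (hy : y ∈ parity k) (h0 : br x y = 0) : br y x = 0 := by
  rw [h.skew k j y hy x hx, h0, smul_zero, neg_zero]

theorem IsHomLieStructure.even_bracket_mem (h : IsHomLieStructure parity br σ) {x y : V}
    {k : ZMod 2} (hx : x ∈ parity 0) (hy : y ∈ parity k) : br x y ∈ parity k := by
  simpa using h.bracket_even 0 k x hx y hy

/-- The Hom-Jacobi identity for two commuting even elements. -/
theorem IsHomLieStructure.bracket_map_comm (h : IsHomLieStructure parity br σ) {x y z : V}
    {k : ZMod 2} (hx : x ∈ parity 0) (hy : y ∈ parity 0) (hz : z ∈ parity k) (hxy : br x y = 0) :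
    br (σ x) (br y z) = br (σ y) (br x z) := by
  have := h.hom_jacobi 0 0 k x hx y hy z hz
  simp only [ZMod.val_zero, zero_mul, mul_zero, pow_zero, one_smul, hxy, map_zero, add_zero] at this
  rw [h.skew_even hx hz, map_neg, eq_neg_iff_add_eq_zero]
  exact this

/-- The Hom-Jacobi identity for an even `x` acting as a derivation with `σ x = a x`. -/
theorem IsHomLieStructure.bracket_sub_smul_comm (h : IsHomLieStructure parity br σ) {x y z : V}
    {j k : ZMod 2} {a : F} (hx : x ∈ parity 0) (hy : y ∈ parity j) (hz : z ∈ parity k)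
    (hder : br x (br y z) = br (br x y) z + br y (br x z)) (ha : σ x = a • x) :
    br (σ y - a • y) (br x z) = (-1 : F) ^ (k.val * j.val) • br (σ z - a • z) (br x y) := by
  -- With σx = ax, the first term is a[x,[y,z]], which `hder` splits in two. The two halves are the
  -- corrections that turn σy and σz in the other terms into σy - ay and σz - az.
  have := h.hom_jacobi 0 j k x hx y hy z hz
  simp only [ZMod.val_zero, zero_mul, mul_zero, pow_zero, one_smul, ha, map_smul,
    LinearMap.smul_apply, hder, smul_add] at this
  rw [h.skew j k _ (h.even_bracket_mem hx hy) z hz, ← neg_eq_iff_eq_neg.mpr (h.skew_even hx hz),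
    map_neg, mul_comm j.val] at this
  simp only [map_sub, map_smul, LinearMap.sub_apply, LinearMap.smul_apply, smul_sub,
    smul_neg] at this ⊢
  rw [smul_comm a] at this
  linear_combination (norm := module) (-1 : F) • this

/-- Suppose that the commuting even elements `D i` act as derivations, that the even
elements commuting with all `D j z` (`j ≠ i`, `D i z = 0`) are multiples of `D i`, and that the `D i`-images of
elements killed by some `D m` have trivial centralizer. Then a nonzero Hom-Lie structure is the
identity. -/
theorem IsHomLieStructure.eq_id (h : IsHomLieStructure parity br σ) (hσ : σ ≠ 0)
    (htop : ∀ x, ∃ x₀ ∈ parity 0, ∃ x₁ ∈ parity 1, x = x₀ + x₁)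
    (D : ι → V) (hD : ∀ i, D i ∈ parity 0) (hcomm : ∀ i j, br (D i) (D j) = 0)
    (hder : ∀ i y z, br (D i) (br y z) = br (br (D i) y) z + br y (br (D i) z))
    (hcent : ∀ i, ∀ y ∈ parity 0, (∀ j ≠ i, ∀ k, ∀ z ∈ parity k, br (D i) z = 0 →
      br (br (D j) z) y = 0) → ∃ a : F, y = a • D i)
    (hmix : ∀ i j, i ≠ j → ∃ k, ∃ z ∈ parity k, br (D i) (br (D j) z) ≠ 0)
    (hsep : ∀ i y, (∀ k, ∀ z ∈ parity k, (∃ m, br (D m) z = 0) → br (br (D i) z) y = 0) → y = 0)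
    (hι : Nontrivial ι) (x : V) : σ x = x := by
  -- For z killed by D_i the collapsed identity reads [σD_i, D_j z] = [σD_j, D_i z] = 0, which is
  -- the input of `hcent`.
  have hscal : ∀ i, ∃ a : F, σ (D i) = a • D i := by
    intro i
    refine hcent i _ (h.map_even 0 _ (hD i)) fun j _ k z hz h0 => ?_
    refine h.bracket_eq_zero_comm (h.map_even 0 _ (hD i)) (h.even_bracket_mem (hD j) hz) ?_
    rw [h.bracket_map_comm (hD i) (hD j) hz (hcomm i j), h0, map_zero]
  choose a ha using hscal
  have hDD : ∀ i j z, br (D i) (br (D j) z) = br (D j) (br (D i) z) := by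
    intro i j z
    rw [hder, hcomm, map_zero, LinearMap.zero_apply, zero_add]
  -- The same identity now reads a_i D_i D_j z = a_j D_j D_i z, and `hmix` supplies z for which this
  -- element is nonzero.
  have haeq : ∀ i j, a i = a j := by
    intro i j
    by_cases hij : i = j
    · rw [hij]
    obtain ⟨k, z, hz, hne⟩ := hmix i j hij
    have := h.bracket_map_comm (hD i) (hD j) hz (hcomm i j)
    rw [ha, ha, map_smul, map_smul, LinearMap.smul_apply, LinearMap.smul_apply, ← hDD i j,
      ← sub_eq_zero, ← sub_smul, smul_eq_zero] at this
    exact sub_eq_zero.mp (this.resolve_right hne)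
  obtain ⟨i, j, hij⟩ := hι
  have ha' : ∀ m, σ (D m) = a i • D m := fun m => by rw [ha, haeq m i]
  have hsub : ∀ p, ∀ y ∈ parity p, σ y - a i • y ∈ parity p := fun p y hy =>
    sub_mem (h.map_even p y hy) (Submodule.smul_mem _ _ hy)
  -- Here y is killed by D_m, so every z may be used in the exchange identity; the restriction on z
  -- offered by `hsep` is not needed.
  have hker : ∀ m p, ∀ y ∈ parity p, br (D m) y = 0 → σ y - a i • y = 0 := by
    intro m p y hy h0
    refine hsep m _ fun k z hz _ => ?_
    refine h.bracket_eq_zero_comm (hsub p y hy) (h.even_bracket_mem (hD m) hz) ?_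
    rw [h.bracket_sub_smul_comm (hD m) hy hz (hder m y z) (ha' m), h0, map_zero, smul_zero]
  -- Now y is arbitrary and z is killed by some D_m. By `hker` the factor σz - az vanishes, which is
  -- why `hsep` has to work with this smaller set of z.
  have hall : ∀ p, ∀ y ∈ parity p, σ y - a i • y = 0 := by
    intro p y hy
    refine hsep i _ fun k z hz ⟨m, h0⟩ => ?_
    refine h.bracket_eq_zero_comm (hsub p y hy) (h.even_bracket_mem (hD i) hz) ?_
    rw [h.bracket_sub_smul_comm (hD i) hy hz (hder i y z) (ha' i), hker m k z hz h0, map_zero,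
      LinearMap.zero_apply, smul_zero]
  have heq : ∀ y, σ y = a i • y := by
    intro y
    obtain ⟨y₀, h₀, y₁, h₁, rfl⟩ := htop y
    rw [map_add, smul_add, sub_eq_zero.mp (hall 0 y₀ h₀), sub_eq_zero.mp (hall 1 y₁ h₁)]
  have hne : a i ≠ 0 := fun h0 => hσ (LinearMap.ext fun y => by simp [heq y, h0])
  -- On a nonzero bracket [D_i, D_j z], multiplicativity compares a with a².
  have hone : a i = 1 := by
    obtain ⟨k, z, hz, hz0⟩ := hmix i j hij
    have := h.map_bracket 0 k _ (hD i) _ (h.even_bracket_mem (hD j) hz)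
    rw [heq, heq, heq (br (D j) z), map_smul, map_smul, LinearMap.smul_apply, ← sub_eq_zero,
      smul_smul, ← sub_smul, smul_eq_zero] at this
    have h2 := this.resolve_right hz0
    have h3 : a i * (1 - a i) = 0 := by linear_combination h2
    linear_combination -(mul_eq_zero.mp h3).resolve_left hne
  rw [heq, hone, one_smul]

end Rigidity

/-! ### Splitting into even and odd parts -/

section Parity

variable {F A B : Type*} [Field F] [AddCommGroup A] [Module F A] [AddCommGroup B] [Module F B]

theorem mem_parityOn_zero {S : Submodule F (A × B)} {x : S} :
    x ∈ parityOn S 0 ↔ x.1.2 = 0 := by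
  simp [parityOn]

theorem mem_parityOn_one {S : Submodule F (A × B)} {x : S} :
    x ∈ parityOn S 1 ↔ x.1.1 = 0 := by
  simp [parityOn]

/-- Stability under projection to the even factor is enough, since the odd part is then the
difference. -/
theorem exists_parityOn_add {S : Submodule F (A × B)} (hS : ∀ x ∈ S, (x.1, (0 : B)) ∈ S) (x : S) :
    ∃ x₀ ∈ parityOn S 0, ∃ x₁ ∈ parityOn S 1, x = x₀ + x₁ := by
  have h := hS x x.2
  refine ⟨⟨_, h⟩, mem_parityOn_zero.2 rfl, x - ⟨_, h⟩, mem_parityOn_one.2 ?_, by abel⟩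
  simp

end Parity

/-! ### Partial derivatives as derivations of the natural operations -/

section Calculus

variable {F : Type*} [Field F] {n : ℕ}

/-- All the operations are bilinear in the coefficients and their partial derivatives, with constant
coefficients. Since partial derivatives commute, ∂_i obeys the Leibniz rule on each. These rules add
up to the Jacobi identity for ∂_i, the only case needed. -/
theorem pderiv_actFun (i : Fin n) (X : Fin n → MvPowerSeries (Fin n) F)
    (f : MvPowerSeries (Fin n) F) : pderiv F i (actFun X f) =
      actFun (fun k => pderiv F i (X k)) f + actFun X (pderiv F i f) := by
  simp only [actFun, map_sum, Derivation.leibniz, smul_eq_mul, ← Finset.sum_add_distrib]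
  refine Finset.sum_congr rfl fun k _ => ?_
  rw [pderiv_comm i k]
  ring

theorem pderiv_lieVec (i : Fin n) (X Y : Fin n → MvPowerSeries (Fin n) F) (t : Fin n) :
    pderiv F i (lieVec X Y t) =
      lieVec (fun k => pderiv F i (X k)) Y t + lieVec X (fun k => pderiv F i (Y k)) t := by
  simp only [lieVec, map_sub, pderiv_actFun]
  ring

theorem pderiv_lieForm (i : Fin n) (X : Fin n → MvPowerSeries (Fin n) F)
    (ω : Fin n → Fin n → MvPowerSeries (Fin n) F) (s t : Fin n) :
    pderiv F i (lieForm X ω s t) =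
      lieForm (fun k => pderiv F i (X k)) ω s t + lieForm X (fun k l => pderiv F i (ω k l)) s t := by
  simp only [lieForm, map_add, pderiv_actFun]
  have : ∀ a b c d : MvPowerSeries (Fin n) F, a + b + (c + d) = a + c + (b + d) :=
    fun _ _ _ _ => by ring
  rw [this, ← Finset.sum_add_distrib, map_sum]
  congr 1
  refine Finset.sum_congr rfl fun k _ => ?_
  simp only [map_add, Derivation.leibniz, smul_eq_mul, pderiv_comm i s, pderiv_comm i t]
  ring

theorem pderiv_dWedge (i : Fin n) (f g : MvPowerSeries (Fin n) F) (s t : Fin n) :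
    pderiv F i (dWedge f g s t) = dWedge (pderiv F i f) g s t + dWedge f (pderiv F i g) s t := by
  simp only [dWedge, map_sub, Derivation.leibniz, smul_eq_mul, pderiv_comm i s, pderiv_comm i t]
  ring

theorem pderiv_divergence (i : Fin n) (X : Fin n → MvPowerSeries (Fin n) F) :
    pderiv F i (divergence X) = divergence fun k => pderiv F i (X k) := by
  simp only [divergence, map_sum]
  exact Finset.sum_congr rfl fun k _ => pderiv_comm i k _

theorem pderiv_dOne (i : Fin n) (θ : Fin n → MvPowerSeries (Fin n) F) (s t : Fin n) :
    pderiv F i (dOne θ s t) = dOne (fun k => pderiv F i (θ k)) s t := by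
  simp only [dOne, map_sub, pderiv_comm i s, pderiv_comm i t]

/-- The coordinate vector field `f ∂_k`. -/
def vec (k : Fin n) (f : MvPowerSeries (Fin n) F) : Fin n → MvPowerSeries (Fin n) F :=
  Pi.single k f

theorem vec_self (k : Fin n) (f : MvPowerSeries (Fin n) F) : vec k f k = f := Pi.single_eq_same _ _

theorem vec_of_ne {k l : Fin n} (h : l ≠ k) (f : MvPowerSeries (Fin n) F) : vec k f l = 0 :=
  Pi.single_eq_of_ne h _

theorem vec_apply (k l : Fin n) (f : MvPowerSeries (Fin n) F) :
    vec k f l = if l = k then f else 0 := Pi.single_apply _ _ _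

theorem pderiv_vec (i k l : Fin n) (f : MvPowerSeries (Fin n) F) :
    pderiv F i (vec k f l) = vec k (pderiv F i f) l := by
  simp only [vec_apply]
  split_ifs <;> simp

/-! ### Brackets with the fields f ∂_k -/

theorem actFun_vec (k : Fin n) (f g : MvPowerSeries (Fin n) F) :
    actFun (vec k f) g = f * pderiv F k g := by
  simp [actFun, vec_apply]

theorem divergence_vec (k : Fin n) (f : MvPowerSeries (Fin n) F) :
    divergence (vec k f) = pderiv F k f := by
  simp only [divergence, pderiv_vec]
  simp [vec_apply]

theorem actFun_X (Y : Fin n → MvPowerSeries (Fin n) F) (j : Fin n) : actFun Y (X j) = Y j := by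
  rw [actFun, Finset.sum_eq_single_of_mem j (Finset.mem_univ _)]
  · rw [pderiv_X_self, mul_one]
  · intro b _ hb
    rw [pderiv_X_of_ne hb.symm, mul_zero]

theorem vec_zero (k : Fin n) : vec k (0 : MvPowerSeries (Fin n) F) = 0 := Pi.single_zero _

/-- The term Y(f) is kept whole on purpose: for Y with constant coefficients and f a coordinate,
`actFun_X` makes it a component of Y, so brackets with such fields read off components. -/
theorem lieVec_vec (k : Fin n) (f : MvPowerSeries (Fin n) F)
    (Y : Fin n → MvPowerSeries (Fin n) F) (t : Fin n) :
    lieVec (vec k f) Y t = f * pderiv F k (Y t) - vec k (actFun Y f) t := by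
  rw [lieVec, actFun_vec]
  simp only [actFun, pderiv_vec]
  by_cases h : t = k
  · subst h; simp [vec_self]
  · simp [vec_of_ne h]

theorem lieForm_vec (k : Fin n) (f : MvPowerSeries (Fin n) F)
    (ω : Fin n → Fin n → MvPowerSeries (Fin n) F) (s t : Fin n) :
    lieForm (vec k f) ω s t =
      f * pderiv F k (ω s t) + (pderiv F s f * ω k t + pderiv F t f * ω s k) := by
  simp only [lieForm, actFun_vec, pderiv_vec]
  simp [vec_apply, Finset.sum_add_distrib]

theorem lieVec_vec_one (k : Fin n) (Y : Fin n → MvPowerSeries (Fin n) F) (t : Fin n) :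
    lieVec (vec k 1) Y t = pderiv F k (Y t) := by
  simp [lieVec_vec, actFun, vec_apply]

theorem lieForm_vec_one (k : Fin n) (ω : Fin n → Fin n → MvPowerSeries (Fin n) F) (s t : Fin n) :
    lieForm (vec k 1) ω s t = pderiv F k (ω s t) := by
  simp [lieForm_vec]

theorem vec_mem {c : CoeffKind} {f : MvPowerSeries (Fin n) F} (hf : f ∈ coeffRing F n c)
    (k l : Fin n) : vec k f l ∈ coeffRing F n c := by
  rw [vec_apply]
  split_ifs
  · exact hf
  · exact zero_mem _

theorem X_mem_coeffRing (c : CoeffKind) (i : Fin n) :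
    (X i : MvPowerSeries (Fin n) F) ∈ coeffRing F n c := by
  cases c with
  | formal => exact Algebra.mem_top
  | polynomial => exact ⟨MvPolynomial.X i, by simp [MvPolynomial.coeToMvPowerSeries.algHom_apply]⟩

/-! ### Homogeneous series and criteria for being constant -/

theorem IsHom.one (w : Fin n → ℤ) : IsHom w 0 (1 : MvPowerSeries (Fin n) F) := by
  classical
  intro m h
  rw [coeff_one] at h
  have : m = 0 := by by_contra h0; exact h (if_neg h0)
  simp [this]

theorem IsHom.X (w : Fin n → ℤ) (i : Fin n) :
    IsHom w (w i) (MvPowerSeries.X i : MvPowerSeries (Fin n) F) := by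
  classical
  intro m h
  rw [coeff_X] at h
  have : m = Finsupp.single i 1 := by by_contra h0; exact h (if_neg h0)
  simp [this, Finsupp.single_apply]

/-- A series whose `i`-th partial derivative vanishes does not involve `x_i`. -/
theorem eq_zero_of_coeff_ne_zero [CharZero F] {f : MvPowerSeries (Fin n) F} {i : Fin n}
    (h : pderiv F i f = 0) {m : Fin n →₀ ℕ} (hm : coeff m f ≠ 0) : m i = 0 := by
  by_contra h0
  have hle : Finsupp.single i 1 ≤ m := by
    simpa [Finsupp.single_le_iff] using Nat.one_le_iff_ne_zero.mpr h0
  have := congrArg (coeff (m - Finsupp.single i 1)) h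
  rw [coeff_pderiv, tsub_add_cancel_of_le hle, map_zero, mul_eq_zero] at this
  refine this.elim hm fun h1 => ?_
  -- The factor produced by differentiation is the exponent of x_i in m, written as its predecessor
  -- plus one; it is nonzero in characteristic zero.
  exact Nat.cast_add_one_ne_zero _ h1

theorem exists_smul_one_of_coeff [CharZero F] {f : MvPowerSeries (Fin n) F}
    (h : ∀ m, coeff m f ≠ 0 → m = 0) : ∃ a : F, f = a • 1 := by
  classical
  refine ⟨coeff 0 f, MvPowerSeries.ext fun m => ?_⟩
  by_cases hm : m = 0
  · simp [hm]
  · have : coeff m f = 0 := by by_contra h1; exact hm (h m h1)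
    simp [this, coeff_one, hm]

theorem exists_smul_one_of_pderiv [CharZero F] {f : MvPowerSeries (Fin n) F}
    (h : ∀ i, pderiv F i f = 0) : ∃ a : F, f = a • 1 :=
  exists_smul_one_of_coeff fun _ hm => Finsupp.ext fun i => eq_zero_of_coeff_ne_zero (h i) hm

end Calculus

/-! ### E(5,10) and E(3,6) -/

section FiveVariables

variable {F : Type*} [Field F]

theorem pderiv_formBracket (i : Fin 5) (ω η : Fin 5 → Fin 5 → MvPowerSeries (Fin 5) F)
    (t : Fin 5) : pderiv F i (formBracket ω η t) =
      formBracket (fun k l => pderiv F i (ω k l)) η t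
        + formBracket ω (fun k l => pderiv F i (η k l)) t := by
  simp only [formBracket, map_sum, map_zsmul, Derivation.leibniz, smul_eq_mul,
    ← Finset.sum_add_distrib, ← smul_add]
  refine Finset.sum_congr rfl fun a _ => Finset.sum_congr rfl fun b _ =>
    Finset.sum_congr rfl fun k _ => Finset.sum_congr rfl fun l _ => ?_
  congr 1
  ring

theorem bracket5_vector (Y : Fin 5 → MvPowerSeries (Fin 5) F) (y : Ambient5 F) :
    bracket5 F (Y, 0) y = (lieVec Y y.1, lieForm Y y.2) := by
  have h1 : bracket5 F (Y, 0) y =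
      (lieVec Y y.1 + formBracketₗ 0 y.2, lieForm Y y.2 - lieFormₗ y.1 0) := rfl
  rw [h1, map_zero, map_zero, LinearMap.zero_apply, add_zero, sub_zero]

/-- The derivatives of the constant coefficient 1 drop out, so ad ∂_k differentiates every
coefficient separately. -/
theorem bracket5_coordinate (k : Fin 5) (y : Ambient5 F) :
    bracket5 F (vec k 1, 0) y = (fun t => pderiv F k (y.1 t), fun s t => pderiv F k (y.2 s t)) := by
  rw [bracket5_vector]
  exact Prod.ext (funext fun t => lieVec_vec_one k y.1 t)
    (funext fun s => funext fun t => lieForm_vec_one k y.2 s t)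

theorem bracket5_coordinate_leibniz (k : Fin 5) (y z : Ambient5 F) :
    bracket5 F (vec k 1, 0) (bracket5 F y z) =
      bracket5 F (bracket5 F (vec k 1, 0) y) z + bracket5 F y (bracket5 F (vec k 1, 0) z) := by
  simp only [bracket5_coordinate]
  refine Prod.ext (funext fun t => ?_) (funext fun s => funext fun t => ?_)
  · change pderiv F k (lieVec y.1 z.1 t + formBracket y.2 z.2 t) =
      (lieVec _ z.1 t + formBracket _ z.2 t) + (lieVec y.1 _ t + formBracket y.2 _ t)
    rw [map_add, pderiv_lieVec, pderiv_formBracket]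
    ring
  · change pderiv F k (lieForm y.1 z.2 s t - lieForm z.1 y.2 s t) =
      (lieForm _ z.2 s t - lieForm z.1 _ s t) + (lieForm y.1 _ s t - lieForm _ y.2 s t)
    rw [map_sub, pderiv_lieForm, pderiv_lieForm]
    ring

/-- The 2-form `f dx_s ∧ dx_t`. -/
def form (s t : Fin 5) (f : MvPowerSeries (Fin 5) F) : Fin 5 → Fin 5 → MvPowerSeries (Fin 5) F :=
  fun a b => vec s 1 a * vec t f b - vec t f a * vec s 1 b

theorem form_apply (s t : Fin 5) (f : MvPowerSeries (Fin 5) F) (a b : Fin 5) :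
    form s t f a b = vec s 1 a * vec t f b - vec t f a * vec s 1 b := rfl

theorem isSkew_form (s t : Fin 5) (f : MvPowerSeries (Fin 5) F) : IsSkew (form s t f) := by
  intro a b
  simp only [form]
  ring

theorem pderiv_form (i s t : Fin 5) (f : MvPowerSeries (Fin 5) F) (a b : Fin 5) :
    pderiv F i (form s t f a b) = form s t (pderiv F i f) a b := by
  simp only [form, map_sub, Derivation.leibniz, smul_eq_mul, pderiv_vec]
  simp only [Derivation.map_one_eq_zero, vec_apply, ite_self, mul_zero, add_zero, zero_add]
  ring

/-- The form is x_s dx_s ∧ dx_t, whose differential is dx_s ∧ dx_s ∧ dx_t = 0. -/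
theorem isClosedForm_form_X (s t : Fin 5) :
    IsClosedForm (form s t (X s : MvPowerSeries (Fin 5) F)) := by
  intro i j k
  have h1 : ∀ i, pderiv F i (X s : MvPowerSeries (Fin 5) F) = vec s 1 i := fun i => by
    rw [pderiv_X, vec, Pi.single_apply, Pi.single_apply]
    simp only [eq_comm]
  have h2 : ∀ (f : MvPowerSeries (Fin 5) F) b, vec t f b = f * vec t 1 b := fun f b => by
    simp [vec_apply]
  simp only [pderiv_form]
  simp only [form_apply, h1]
  rw [h2 (vec s 1 i), h2 (vec s 1 i) j, h2 (vec s 1 j), h2 (vec s 1 j) k, h2 (vec s 1 k),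
    h2 (vec s 1 k) i]
  ring

theorem form_mem {c : CoeffKind} {f : MvPowerSeries (Fin 5) F} (hf : f ∈ coeffRing F 5 c)
    (s t a b : Fin 5) : form s t f a b ∈ coeffRing F 5 c :=
  sub_mem (mul_mem (vec_mem (one_mem _) _ _) (vec_mem hf _ _))
    (mul_mem (vec_mem hf _ _) (vec_mem (one_mem _) _ _))

/-- In L_Y(dx_s ∧ dx_t) = dY_s ∧ dx_t + dx_s ∧ dY_t the first term vanishes, and the second displays
the partial derivatives of Y_t. This detects components of Y along coordinates outside the range of
`e`, in E(3,6) those along x_4 and x_5. -/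
theorem lieForm_form_one (Y : Fin 5 → MvPowerSeries (Fin 5) F) {s t b : Fin 5} (hst : s ≠ t)
    (hb : b ≠ s) (hY : Y s = 0) : lieForm Y (form s t 1) s b = pderiv F b (Y t) := by
  have h1 : actFun Y (form s t 1 s b) = 0 := by
    simp only [actFun, pderiv_form]
    simp [form_apply, vec_apply]
  rw [lieForm, h1, zero_add, Finset.sum_eq_single_of_mem t (Finset.mem_univ t)]
  · simp [form_apply, vec_apply, hst, hst.symm, hb]
  · intro k _ hk
    by_cases hks : k = s
    · subst hks; simp [hY]
    · simp [form_apply, vec_apply, hk, hks, hst, hb]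

/-- A subalgebra `S` of `E(5,10)` which contains the divergence-free fields in the coordinates
`x_{e i}` and some closed 2-forms, and is small in the directions of the other coordinates. -/
structure IsCoordinateSubalgebra {ι : Type*} (c : CoeffKind) (S : Submodule F (Ambient5 F))
    (e : ι → Fin 5) (w : Fin 5 → ℤ) : Prop where
  le : S ≤ E510 F c
  bracket_mem : ∀ x ∈ S, ∀ y ∈ S, bracket5 F x y ∈ S
  even_mem : ∀ x ∈ S, (x.1, 0) ∈ S
  injective : Function.Injective e
  weight_eq_zero : ∀ i, w (e i) = 0
  exists_ne : ∀ i j : ι, ∃ k, k ≠ i ∧ k ≠ j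
  vector_mem : ∀ Y : Fin 5 → MvPowerSeries (Fin 5) F, (∀ t, Y t ∈ coeffRing F 5 c) →
    divergence Y = 0 → (∀ t, IsHom w 0 (Y t)) → (∀ t ∉ Set.range e, Y t = 0) → (Y, 0) ∈ S
  form_mem : ∀ i, ∀ t ∉ Set.range e, (0, form (e i) t (X (e i))) ∈ S
  vector_eq_zero : ∀ y ∈ S, ∀ t ∉ Set.range e, (∀ a, pderiv F a (y.1 t) = 0) → y.1 t = 0
  form_eq_zero : ∀ y ∈ S, ∀ s ∉ Set.range e, ∀ t ∉ Set.range e, y.2 s t = 0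
  eq_const : ∀ y ∈ S, ∀ i, (∀ k, pderiv F (e k) (y.1 (e i)) = 0) → ∃ a : F, y.1 (e i) = a • 1

namespace IsCoordinateSubalgebra

variable {ι : Type*} {c : CoeffKind} {S : Submodule F (Ambient5 F)} {e : ι → Fin 5}
  {w : Fin 5 → ℤ}

/-- Functions of the coordinates `x_{e i}`. -/
def IsCoordinateFun (c : CoeffKind) (w : Fin 5 → ℤ) (f : MvPowerSeries (Fin 5) F) : Prop :=
  f ∈ coeffRing F 5 c ∧ IsHom w 0 f

theorem IsCoordinateFun.mul {f g : MvPowerSeries (Fin 5) F} (hf : IsCoordinateFun c w f)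
    (hg : IsCoordinateFun c w g) : IsCoordinateFun c w (f * g) :=
  ⟨mul_mem hf.1 hg.1, hf.2.mul hg.2 (by ring)⟩

theorem IsCoordinateFun.add {f g : MvPowerSeries (Fin 5) F} (hf : IsCoordinateFun c w f)
    (hg : IsCoordinateFun c w g) : IsCoordinateFun c w (f + g) :=
  ⟨add_mem hf.1 hg.1, hf.2.add hg.2⟩

theorem IsCoordinateFun.zero : IsCoordinateFun c w (0 : MvPowerSeries (Fin 5) F) :=
  ⟨zero_mem _, IsHom.zero _ _⟩

theorem IsCoordinateFun.one : IsCoordinateFun c w (1 : MvPowerSeries (Fin 5) F) :=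
  ⟨one_mem _, IsHom.one _⟩

theorem coordinateFun_X (H : IsCoordinateSubalgebra c S e w) (i : ι) :
    IsCoordinateFun c w (X (e i) : MvPowerSeries (Fin 5) F) :=
  ⟨X_mem_coeffRing c _, H.weight_eq_zero i ▸ IsHom.X w (e i)⟩

/-- The source of the even test elements. A single f ∂_k has divergence zero only if f does not
involve x_k; otherwise a second field has to compensate. -/
theorem vec_sub_vec_mem (H : IsCoordinateSubalgebra c S e w) {f g : MvPowerSeries (Fin 5) F}
    (hf : IsCoordinateFun c w f) (hg : IsCoordinateFun c w g) {k l : ι}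
    (hfg : pderiv F (e k) f = pderiv F (e l) g) : (vec (e k) f - vec (e l) g, 0) ∈ S := by
  have hh : ∀ (f : MvPowerSeries (Fin 5) F) (k t : Fin 5), IsCoordinateFun c w f → IsHom w 0 (vec k f t) := by
    intro f k t hf
    rw [vec_apply]
    split_ifs
    · exact hf.2
    · exact IsHom.zero _ _
  refine H.vector_mem _ (fun t => sub_mem (vec_mem hf.1 _ _) (vec_mem hg.1 _ _)) ?_
    (fun t => (hh _ _ t hf).sub (hh _ _ t hg)) fun t ht => ?_
  · have : vec (e k) f - vec (e l) g = vec (e k) f + (-1 : F) • vec (e l) g := by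
      rw [neg_one_smul, sub_eq_add_neg]
    rw [this, divergence_add, divergence_smul, divergence_vec, divergence_vec, hfg]
    simp
  · have h1 : ∀ k, t ≠ e k := fun k h => ht ⟨k, h.symm⟩
    simp [vec_of_ne (h1 _)]

theorem vec_mem (H : IsCoordinateSubalgebra c S e w) {f : MvPowerSeries (Fin 5) F}
    (hf : IsCoordinateFun c w f) {k : ι} (h0 : pderiv F (e k) f = 0) : (vec (e k) f, 0) ∈ S := by
  have := H.vec_sub_vec_mem hf IsCoordinateFun.zero (k := k) (l := k) (by rw [h0, map_zero])
  rwa [vec_zero, sub_zero] at this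

/-- The bracket on `S`. -/
def bracket (H : IsCoordinateSubalgebra c S e w) : S →ₗ[F] S →ₗ[F] S :=
  restrictBracket (bracket5 F) S H.bracket_mem

/-- The element `∂_{e i}` of `S`. -/
def coordinate (H : IsCoordinateSubalgebra c S e w) (i : ι) : S :=
  ⟨(vec (e i) 1, 0), H.vec_mem IsCoordinateFun.one (Derivation.map_one_eq_zero _)⟩

theorem bracket_coordinate (H : IsCoordinateSubalgebra c S e w) (i : ι) (y : S) :
    (H.bracket (H.coordinate i) y : Ambient5 F) =
      (fun t => pderiv F (e i) (y.1.1 t), fun s t => pderiv F (e i) (y.1.2 s t)) :=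
  bracket5_coordinate (e i) y.1

theorem bracket_coordinate_vec_sub_vec (H : IsCoordinateSubalgebra c S e w) (i : ι) {z : S}
    {f g : MvPowerSeries (Fin 5) F} {k l : ι} (hz : z.1 = (vec (e k) f - vec (e l) g, 0)) :
    (H.bracket (H.coordinate i) z : Ambient5 F) =
      (vec (e k) (pderiv F (e i) f) - vec (e l) (pderiv F (e i) g), 0) := by
  rw [bracket_coordinate, hz]
  refine Prod.ext (funext fun t => ?_) (funext fun s => funext fun t => ?_)
  · simp [pderiv_vec]
  · simp

theorem bracket_coordinate_vec (H : IsCoordinateSubalgebra c S e w) (i : ι) {z : S}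
    {f : MvPowerSeries (Fin 5) F} {k : ι} (hz : z.1 = (vec (e k) f, 0)) :
    (H.bracket (H.coordinate i) z : Ambient5 F) = (vec (e k) (pderiv F (e i) f), 0) := by
  rw [bracket_coordinate, hz]
  refine Prod.ext (funext fun t => ?_) (funext fun s => funext fun t => ?_)
  · simp [pderiv_vec]
  · simp

theorem bracket_coordinate_form (H : IsCoordinateSubalgebra c S e w) (i : ι) {z : S}
    {f : MvPowerSeries (Fin 5) F} {s t : Fin 5} (hz : z.1 = (0, form s t f)) :
    (H.bracket (H.coordinate i) z : Ambient5 F) = (0, form s t (pderiv F (e i) f)) := by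
  rw [bracket_coordinate, hz]
  refine Prod.ext (funext fun t => ?_) (funext fun s => funext fun t => ?_)
  · simp
  · simp [pderiv_form]

theorem pderiv_X_same (i : ι) : pderiv F (e i) (X (e i) : MvPowerSeries (Fin 5) F) = 1 :=
  pderiv_X_self

theorem pderiv_X_ne (H : IsCoordinateSubalgebra c S e w) {i j : ι} (h : j ≠ i) :
    pderiv F (e i) (X (e j) : MvPowerSeries (Fin 5) F) = 0 :=
  pderiv_X_of_ne (H.injective.ne h)

/-- The fields of `S` commuting with some `D_j z` (`D_i z = 0`) are the multiples of `D_i`. -/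
theorem exists_smul_coordinate [CharZero F] (H : IsCoordinateSubalgebra c S e w) (i : ι) (y : S)
    (hy : y ∈ parityOn S 0)
    (h : ∀ j ≠ i, ∀ k, ∀ z ∈ parityOn S k, H.bracket (H.coordinate i) z = 0 →
      H.bracket (H.bracket (H.coordinate j) z) y = 0) : ∃ a : F, y = a • H.coordinate i := by
  have hy2 : y.1.2 = 0 := mem_parityOn_zero.1 hy
  have hd : ∀ k t, pderiv F (e k) (y.1.1 t) = 0 := by
    intro k t
    -- Test element x_j ∂_k: j ≠ k makes it divergence-free, j ≠ i makes ∂_i kill it, and ∂_j turns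
    -- it into ∂_k. So y has coefficients independent of x_k.
    obtain ⟨j, hjk, hji⟩ := H.exists_ne k i
    let z : S := ⟨(vec (e k) (X (e j)), 0), H.vec_mem (H.coordinateFun_X j) (H.pderiv_X_ne hjk)⟩
    have hz := h j hji 0 z (mem_parityOn_zero.2 rfl) (Subtype.ext (by
      rw [H.bracket_coordinate_vec i rfl, H.pderiv_X_ne hji]
      exact Prod.ext (vec_zero _) rfl))
    have h1 := congrArg Subtype.val hz
    change bracket5 F (H.bracket (H.coordinate j) z).1 y.1 = 0 at h1
    rw [H.bracket_coordinate_vec j rfl, pderiv_X_same, bracket5_coordinate] at h1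
    exact congrFun (congrArg Prod.fst h1) t
  have h0 : ∀ j, j ≠ i → y.1.1 (e j) = 0 := by
    intro j hji
    have hx := H.coordinateFun_X j
    -- Test element x_j² ∂_i, with derivative 2x_j ∂_i. Its bracket with y, whose coefficients are
    -- killed by ∂_i, is -2y_j ∂_i.
    let z : S := ⟨(vec (e i) (X (e j) * X (e j)), 0), H.vec_mem (hx.mul hx)
      (by simp [H.pderiv_X_ne hji])⟩
    have hz := h j hji 0 z (mem_parityOn_zero.2 rfl) (Subtype.ext (by
      rw [H.bracket_coordinate_vec i rfl, Derivation.leibniz, H.pderiv_X_ne hji, smul_zero,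
        add_zero]
      exact Prod.ext (vec_zero _) rfl))
    have h1 := congrArg Subtype.val hz
    change bracket5 F (H.bracket (H.coordinate j) z).1 y.1 = 0 at h1
    rw [H.bracket_coordinate_vec j rfl, Derivation.leibniz, pderiv_X_same, bracket5_vector] at h1
    have h2 := congrFun (congrArg Prod.fst h1) (e i)
    simp only [lieVec_vec, hd, vec_self, smul_eq_mul, mul_one, actFun_add_right,
      Prod.fst_zero, Pi.zero_apply] at h2
    rw [actFun_X] at h2
    have h4 : (2 : F) • y.1.1 (e j) = 0 := by
      rw [two_smul]
      linear_combination -h2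
    exact (smul_eq_zero.1 h4).resolve_left two_ne_zero
  have h5 : ∀ t, t ∉ Set.range e → y.1.1 t = 0 := by
    intro t ht
    refine H.vector_eq_zero y.1 y.2 t ht fun b => ?_
    obtain ⟨j, hji, -⟩ := H.exists_ne i i
    by_cases hb : b = e j
    · rw [hb, hd]
    -- The derivative of this odd test element along x_j is dx_j ∧ dx_t. Its bracket with the even y
    -- is -L_y(dx_j ∧ dx_t), whose (j, b) entry is -∂_b y_t because y_j = 0.
    let z : S := ⟨(0, form (e j) t (X (e j))), H.form_mem j t ht⟩
    have hz := h j hji 1 z (mem_parityOn_one.2 rfl) (Subtype.ext (by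
      rw [H.bracket_coordinate_form i rfl, H.pderiv_X_ne hji]
      refine Prod.ext rfl (funext fun s => funext fun t => ?_)
      simp [form_apply, vec_apply]))
    have h1 := congrArg Subtype.val hz
    change bracket5 F (H.bracket (H.coordinate j) z).1 y.1 = 0 at h1
    rw [H.bracket_coordinate_form j rfl, pderiv_X_same] at h1
    have h2 : lieForm 0 y.1.2 (e j) b - lieForm y.1.1 (form (e j) t 1) (e j) b = 0 :=
      congrFun (congrFun (congrArg Prod.snd h1) (e j)) b
    rw [lieForm_form_one _ (fun h => ht ⟨j, h⟩) hb (h0 j hji), hy2] at h2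
    simpa [lieForm, actFun] using h2
  obtain ⟨a, ha⟩ := H.eq_const y.1 y.2 i fun k => hd k _
  refine ⟨a, Subtype.ext (Prod.ext (funext fun t => ?_) (hy2.trans (smul_zero a).symm))⟩
  change y.1.1 t = a • vec (e i) 1 t
  by_cases ht : t = e i
  · rw [ht, ha, vec_self]
  rw [vec_of_ne ht, smul_zero]
  by_cases hr : t ∈ Set.range e
  · obtain ⟨j, rfl⟩ := hr
    exact h0 j fun hji => ht (by rw [hji])
  · exact h5 t hr

/-- The elements `D_i z`, where `z` is killed by some `D_m`, have trivial centralizer in `S`. -/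
theorem eq_zero_of_bracket [CharZero F] (H : IsCoordinateSubalgebra c S e w) (i : ι) (y : S)
    (h : ∀ k, ∀ z ∈ parityOn S k, (∃ m, H.bracket (H.coordinate m) z = 0) →
      H.bracket (H.bracket (H.coordinate i) z) y = 0) : y = 0 := by
  obtain ⟨-, -, -, hskew, -⟩ := H.le y.2
  -- The element f ∂_k - g ∂_l is admissible as soon as one coordinate x_m is absent from both f and
  -- g.
  have key : ∀ {k l : ι} {f g : MvPowerSeries (Fin 5) F}, IsCoordinateFun c w f →
      IsCoordinateFun c w g → pderiv F (e k) f = pderiv F (e l) g →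
      (∃ m, pderiv F (e m) f = 0 ∧ pderiv F (e m) g = 0) →
      bracket5 F (vec (e k) (pderiv F (e i) f) - vec (e l) (pderiv F (e i) g), 0) y.1 = 0 := by
    rintro k l f g hf hg hfg ⟨m, hmf, hmg⟩
    let z : S := ⟨_, H.vec_sub_vec_mem hf hg hfg⟩
    have hz := h 0 z (mem_parityOn_zero.2 rfl) ⟨m, Subtype.ext (by
      rw [H.bracket_coordinate_vec_sub_vec m rfl, hmf, hmg]
      refine Prod.ext ?_ rfl
      funext t
      simp [vec_apply])⟩
    have h1 := congrArg Subtype.val hz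
    change bracket5 F (H.bracket (H.coordinate i) z).1 y.1 = 0 at h1
    rwa [H.bracket_coordinate_vec_sub_vec i rfl] at h1
  have hx := H.coordinateFun_X
  have hd : ∀ k, (∀ t, pderiv F (e k) (y.1.1 t) = 0) ∧ ∀ s t, pderiv F (e k) (y.1.2 s t) = 0 := by
    intro k
    have h1 : bracket5 F (vec (e k) 1, 0) y.1 = 0 := by
      obtain ⟨l, hli, -⟩ := H.exists_ne i i
      obtain ⟨m, hmi, hml⟩ := H.exists_ne i l
      by_cases hki : k = i
      -- To reach ∂_i itself, x_i ∂_i must be corrected to x_i ∂_i - x_l ∂_l; the correction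
      -- disappears under ∂_i. For k ≠ i the field x_i ∂_k already works.
      · have := key (k := i) (l := l) (hx i) (hx l) (by rw [pderiv_X_same, pderiv_X_same])
          ⟨m, H.pderiv_X_ne hmi.symm, H.pderiv_X_ne hml.symm⟩
        rw [pderiv_X_same, H.pderiv_X_ne hli] at this
        rwa [vec_zero, sub_zero,
          ← hki] at this
      · have := key (k := k) (l := k) (hx i) IsCoordinateFun.zero
          (by rw [H.pderiv_X_ne (Ne.symm hki), map_zero])
          ⟨m, H.pderiv_X_ne hmi.symm, map_zero _⟩
        rw [pderiv_X_same, map_zero] at this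
        rwa [vec_zero,
          sub_zero] at this
    rw [bracket5_coordinate] at h1
    exact ⟨fun t => congrFun (congrArg Prod.fst h1) t,
      fun s t => congrFun (congrFun (congrArg Prod.snd h1) s) t⟩
  have hE : ∀ l, l ≠ i → (∀ t, vec (e i) (y.1.1 (e i)) t = vec (e l) (y.1.1 (e l)) t) ∧
      ∀ s t, pderiv F s (X (e i)) * y.1.2 (e i) t + pderiv F t (X (e i)) * y.1.2 s (e i) =
        pderiv F s (X (e l)) * y.1.2 (e l) t + pderiv F t (X (e l)) * y.1.2 s (e l) := by
    intro l hli
    obtain ⟨m, hmi, hml⟩ := H.exists_ne i l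
    -- The field x_i² ∂_i - 2x_i x_l ∂_l is divergence-free, and ∂_i sends it to 2(x_i ∂_i - x_l
    -- ∂_l). So y commutes with this diagonal field: along x_i and x_l this annihilates the constant
    -- components, and it equates the weights of x_i and x_l on every surviving form coefficient.
    have h1 := key (k := i) (l := l) ((hx i).mul (hx i))
      (((hx i).mul (hx l)).add ((hx i).mul (hx l)))
      (by simp [H.pderiv_X_ne hli.symm])
      ⟨m, by simp [H.pderiv_X_ne hmi.symm],
        by simp [H.pderiv_X_ne hmi.symm, H.pderiv_X_ne hml.symm]⟩
    have h2 : vec (e i) (pderiv F (e i) (X (e i) * X (e i))) -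
        vec (e l) (pderiv F (e i) (X (e i) * X (e l) + X (e i) * X (e l))) =
        (2 : F) • (vec (e i) (X (e i)) + (-1 : F) • vec (e l) (X (e l))) := by
      funext t
      simp only [Derivation.leibniz, map_add, pderiv_X_same, H.pderiv_X_ne hli, smul_eq_mul,
        mul_one, mul_zero, zero_add, Pi.sub_apply, Pi.smul_apply, Pi.add_apply, vec_apply,
        two_smul, neg_one_smul, Pi.neg_apply]
      split_ifs <;> ring
    rw [h2, bracket5_vector] at h1
    constructor
    · intro t
      have h3 : lieVecₗ ((2 : F) • (vec (e i) (X (e i)) + (-1 : F) • vec (e l) (X (e l)))) y.1.1 t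
        = 0 := congrFun (congrArg Prod.fst h1) t
      rw [map_smul, map_add, map_smul, LinearMap.smul_apply, Pi.smul_apply, smul_eq_zero] at h3
      have h4 : lieVec (vec (e i) (X (e i))) y.1.1 t +
        (-1 : F) • lieVec (vec (e l) (X (e l))) y.1.1 t = 0 := h3.resolve_left two_ne_zero
      rw [lieVec_vec, lieVec_vec, (hd i).1, (hd l).1, actFun_X, actFun_X, neg_one_smul] at h4
      linear_combination -h4
    · intro s t
      have h3 : lieFormₗ ((2 : F) • (vec (e i) (X (e i)) + (-1 : F) • vec (e l) (X (e l)))) y.1.2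
        s t = 0 := congrFun (congrFun (congrArg Prod.snd h1) s) t
      rw [map_smul, map_add, map_smul, LinearMap.smul_apply, Pi.smul_apply, Pi.smul_apply,
        smul_eq_zero] at h3
      have h4 : lieForm (vec (e i) (X (e i))) y.1.2 s t +
        (-1 : F) • lieForm (vec (e l) (X (e l))) y.1.2 s t = 0 := h3.resolve_left two_ne_zero
      rw [lieForm_vec, lieForm_vec, (hd i).2, (hd l).2, neg_one_smul] at h4
      linear_combination h4
  have hself : ∀ s, y.1.2 s s = 0 := by
    intro s
    have h1 : (2 : F) • y.1.2 s s = 0 := by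
      rw [two_smul]
      exact eq_neg_iff_add_eq_zero.1 (hskew s s)
    exact (smul_eq_zero.1 h1).resolve_left two_ne_zero
  have hv : ∀ k, y.1.1 (e k) = 0 := by
    intro k
    by_cases hki : k = i
    · subst hki
      obtain ⟨l, hl, -⟩ := H.exists_ne k k
      have := (hE l hl).1 (e k)
      rwa [vec_self, vec_of_ne (H.injective.ne hl.symm)] at this
    · have := (hE k hki).1 (e k)
      rw [vec_self, vec_of_ne (H.injective.ne hki)] at this
      exact this.symm
  have hfi : ∀ t, y.1.2 (e i) t = 0 := by
    intro t
    by_cases hti : t = e i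
    · rw [hti, hself]
    -- With x_l different from both indices of the coefficient, the x_l side of the weight relation
    -- is zero, while the x_i side is the coefficient itself.
    have : ∃ l, l ≠ i ∧ e l ≠ t := by
      obtain ⟨l, hl, -⟩ := H.exists_ne i i
      obtain ⟨m, hmi, hml⟩ := H.exists_ne i l
      by_cases hlt : e l = t
      · exact ⟨m, hmi, fun h => hml (H.injective (h.trans hlt.symm))⟩
      · exact ⟨l, hl, hlt⟩
    obtain ⟨l, hl, hlt⟩ := this
    have := (hE l hl).2 (e i) t
    rw [pderiv_X_same, H.pderiv_X_ne hl, pderiv_X_of_ne (Ne.symm hti), pderiv_X_of_ne hlt] at this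
    simpa using this
  have hf : ∀ k t, y.1.2 (e k) t = 0 := by
    intro k t
    by_cases hki : k = i
    · rw [hki, hfi]
    by_cases htk : t = e k
    · rw [htk, hself]
    by_cases hti : t = e i
    · rw [hti, hskew, hfi, neg_zero]
    -- Here neither index is x_i, so the x_i side of the relation is zero and the x_k side is the
    -- coefficient.
    have := (hE k hki).2 (e k) t
    rw [pderiv_X_same, H.pderiv_X_ne (Ne.symm hki), pderiv_X_of_ne (Ne.symm hti),
      pderiv_X_of_ne (Ne.symm htk)] at this
    simpa using this.symm
  refine Subtype.ext (Prod.ext (funext fun t => ?_) (funext fun s => funext fun t => ?_))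
  · by_cases hr : t ∈ Set.range e
    · obtain ⟨k, rfl⟩ := hr
      exact hv k
    refine H.vector_eq_zero y.1 y.2 t hr fun b => ?_
    by_cases hb : b = e i
    · rw [hb, (hd i).1]
    obtain ⟨m, hmi, -⟩ := H.exists_ne i i
    let z : S := ⟨(0, form (e i) t (X (e i))), H.form_mem i t hr⟩
    have hz := h 1 z (mem_parityOn_one.2 rfl) ⟨m, Subtype.ext (by
      rw [H.bracket_coordinate_form m rfl, H.pderiv_X_ne hmi.symm]
      refine Prod.ext rfl (funext fun s => funext fun t => ?_)
      simp [form_apply, vec_apply])⟩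
    have h1 := congrArg Subtype.val hz
    change bracket5 F (H.bracket (H.coordinate i) z).1 y.1 = 0 at h1
    rw [H.bracket_coordinate_form i rfl, pderiv_X_same] at h1
    have h2 : lieForm 0 y.1.2 (e i) b - lieForm y.1.1 (form (e i) t 1) (e i) b = 0 :=
      congrFun (congrFun (congrArg Prod.snd h1) (e i)) b
    rw [lieForm_form_one _ (fun h => hr ⟨i, h⟩) hb (hv i)] at h2
    simpa [lieForm, actFun] using h2
  · by_cases hs : s ∈ Set.range e
    · obtain ⟨k, rfl⟩ := hs
      exact hf k t
    by_cases ht : t ∈ Set.range e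
    · obtain ⟨k, rfl⟩ := ht
      exact (hskew (e k) s).trans (by rw [hf, neg_zero]; rfl)
    · exact H.form_eq_zero y.1 y.2 s hs t ht

/-- The witness is x_i x_j ∂_k with a third index k; it is divergence-free and ∂_i∂_j sends it to
∂_k. -/
theorem exists_bracket_ne_zero (H : IsCoordinateSubalgebra c S e w) (i j : ι) (hij : i ≠ j) :
    ∃ k, ∃ z ∈ parityOn S k,
      H.bracket (H.coordinate i) (H.bracket (H.coordinate j) z) ≠ 0 := by
  obtain ⟨k, hki, hkj⟩ := H.exists_ne i j
  refine ⟨0, ⟨(vec (e k) (X (e i) * X (e j)), 0), H.vec_mem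
    ((H.coordinateFun_X i).mul (H.coordinateFun_X j)) ?_⟩, mem_parityOn_zero.2 rfl, fun h0 => ?_⟩
  · simp [H.pderiv_X_ne hki.symm, H.pderiv_X_ne hkj.symm]
  · have h1 := congrArg Subtype.val h0
    rw [H.bracket_coordinate_vec i (H.bracket_coordinate_vec j rfl)] at h1
    have h2 := congrFun (congrArg Prod.fst h1) (e k)
    simp [vec_self, H.pderiv_X_ne hij] at h2

theorem eq_id [CharZero F] (H : IsCoordinateSubalgebra c S e w) (hι : Nontrivial ι)
    {σ : S →ₗ[F] S} (h : IsHomLieStructure (parityOn S) H.bracket σ) (hσ : σ ≠ 0) (x : S) :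
    σ x = x := by
  refine h.eq_id hσ (exists_parityOn_add H.even_mem) H.coordinate
    (fun i => mem_parityOn_zero.2 rfl) (fun i j => Subtype.ext ?_)
    (fun i y z => Subtype.ext (bracket5_coordinate_leibniz (e i) y.1 z.1))
    H.exists_smul_coordinate H.exists_bracket_ne_zero H.eq_zero_of_bracket hι x
  rw [H.bracket_coordinate_vec i (k := j) rfl, Derivation.map_one_eq_zero]
  exact Prod.ext (vec_zero _) rfl

end IsCoordinateSubalgebra

/-! ### E(5,10) and E(3,6) as coordinate subalgebras -/

theorem even_mem_E510 {c : CoeffKind} {x : Ambient5 F} (hx : x ∈ E510 F c) :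
    (x.1, 0) ∈ E510 F c := by
  obtain ⟨h1, -, h3, -, -⟩ := hx
  exact ⟨h1, fun _ _ => zero_mem _, h3, fun i j => by simp, fun i j k => by simp⟩

theorem vector_mem_E510 {c : CoeffKind} {Y : Fin 5 → MvPowerSeries (Fin 5) F}
    (hY : ∀ t, Y t ∈ coeffRing F 5 c) (hdiv : divergence Y = 0) : (Y, 0) ∈ E510 F c :=
  ⟨hY, fun _ _ => zero_mem _, hdiv, fun i j => by simp, fun i j k => by simp⟩

/-- All five coordinates are used, so the clauses about indices outside the range are void, and with
w = 0 every series is homogeneous of degree 0. -/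
theorem isCoordinateSubalgebra_E510 [CharZero F] (c : CoeffKind) :
    IsCoordinateSubalgebra c (E510 F c) id 0 where
  le := le_rfl
  bracket_mem := bracket5_mem_E510 F c
  even_mem := fun _ => even_mem_E510
  injective := Function.injective_id
  weight_eq_zero := fun _ => rfl
  exists_ne := by decide
  vector_mem := fun _ hY hdiv _ _ => vector_mem_E510 hY hdiv
  form_mem := fun i t ht => absurd ⟨t, rfl⟩ ht
  vector_eq_zero := fun y _ t ht => absurd ⟨t, rfl⟩ ht
  form_eq_zero := fun y _ t ht => absurd ⟨t, rfl⟩ ht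
  eq_const := fun _ _ _ h => exists_smul_one_of_pderiv h

theorem weight_castLE (i : Fin 3) :
    (![0, 0, 0, 1, 1] : Fin 5 → ℤ) (Fin.castLE (by decide : 3 ≤ 5) i) = 0 := by
  revert i
  decide

theorem weight_of_notMem_range_castLE {t : Fin 5}
    (ht : t ∉ Set.range (Fin.castLE (by decide : 3 ≤ 5))) :
    (![0, 0, 0, 1, 1] : Fin 5 → ℤ) t = 1 := by
  have h : t = 3 ∨ t = 4 := by
    by_contra h
    refine ht ⟨⟨t, ?_⟩, rfl⟩
    omega
  rcases h with rfl | rfl <;> rfl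

/-- Elements of degree 0 for the second grading have ∂_1, ∂_2, ∂_3 coefficients depending on x_1,
x_2, x_3 only, ∂_4, ∂_5 coefficients linear in x_4, x_5, and no d_45 term. The clauses on the
remaining directions express these facts. -/
theorem isCoordinateSubalgebra_E36 [CharZero F] (c : CoeffKind) :
    IsCoordinateSubalgebra c (E36 F c) (Fin.castLE (by decide : 3 ≤ 5)) ![0, 0, 0, 1, 1] where
  le := inf_le_left
  bracket_mem := bracket5_mem_E36 F c
  even_mem := fun x hx => ⟨even_mem_E510 hx.1, hx.2.1, fun _ _ => IsHom.zero _ _⟩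
  injective := Fin.castLE_injective _
  weight_eq_zero := weight_castLE
  exists_ne := by decide
  vector_mem := by
    refine fun Y hY hdiv hhom h0 => ⟨vector_mem_E510 hY hdiv, fun t => ?_, fun _ _ => IsHom.zero _ _⟩
    by_cases ht : t ∈ Set.range (Fin.castLE (by decide : 3 ≤ 5))
    · obtain ⟨k, rfl⟩ := ht
      rw [weight_castLE]
      exact hhom _
    · change IsHom _ _ (Y t)
      rw [h0 t ht]
      exact IsHom.zero _ _
  form_mem := by
    intro i t ht
    refine ⟨⟨fun _ => zero_mem _, form_mem (X_mem_coeffRing c _) _ _, ?_, isSkew_form _ _ _,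
      isClosedForm_form_X _ _⟩, fun _ => IsHom.zero _ _, fun a b => ?_⟩
    · simp [divergence]
    have hw := weight_castLE i
    have hwt := weight_of_notMem_range_castLE ht
    have hX := IsHom.X (F := F) ![0, 0, 0, 1, 1] (Fin.castLE (by decide : 3 ≤ 5) i)
    rw [hw] at hX
    -- A nonzero entry is ± x_i at a pair of indices of weights 0 and 1, where the prescribed degree
    -- 0 - 0 - 1 + 1 is the weight 0 of x_i.
    simp only [form_apply, vec_apply]
    split_ifs with h1 h2 h3 h4 h5 h6
    all_goals subst_vars
    all_goals simp_all [IsHom.zero, IsHom.neg]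
  vector_eq_zero := by
    rintro y ⟨-, hy, -⟩ t ht h
    obtain ⟨a, ha⟩ := exists_smul_one_of_pderiv h
    have hyt := hy t 0
    have hwt := weight_of_notMem_range_castLE ht
    rw [ha, hwt] at hyt
    -- A nonzero constant has weight 0, but a ∂_4 or ∂_5 coefficient must have weight 1.
    have : a = 0 := by
      by_contra h0
      simpa using hyt (by simpa using h0)
    rw [ha, this, zero_smul]
  form_eq_zero := by
    rintro y ⟨-, -, hy⟩ s hs t ht
    have hws := weight_of_notMem_range_castLE hs
    have hwt := weight_of_notMem_range_castLE ht
    refine MvPowerSeries.ext fun m => ?_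
    by_contra h0
    have := hy s t m h0
    -- The prescribed weight is 0 - 1 - 1 + 1 = -1, and no monomial has negative weight.
    rw [hws, hwt] at this
    simp [Fin.sum_univ_five] at this
    omega
  eq_const := by
    rintro y ⟨-, hy, -⟩ i h
    have hw := weight_castLE i
    refine exists_smul_one_of_coeff fun m hm => ?_
    have hd := hy _ m hm
    rw [hw] at hd
    -- Weight 0 says that the exponents of x_4 and x_5 add up to 0; the hypothesis on derivatives
    -- handles the other three.
    simp [Fin.sum_univ_five] at hd
    have h0 := eq_zero_of_coeff_ne_zero (h 0) hm
    have h1 := eq_zero_of_coeff_ne_zero (h 1) hm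
    have h2 := eq_zero_of_coeff_ne_zero (h 2) hm
    ext t
    fin_cases t
    · exact h0
    · exact h1
    · exact h2
    · change m 3 = 0
      omega
    · change m 4 = 0
      omega

end FiveVariables

/-! ### E(3,8) -/

section ThreeVariables

variable {F : Type*} [Field F]

/-- The componentwise partial derivative. -/
def pderivEven3 (k : Fin 3) (x : Even3 F) : Even3 F :=
  (fun t => pderiv F k (x.1 t), Matrix.of fun a b => pderiv F k (x.2.1 a b),
    fun s t => pderiv F k (x.2.2 s t))

/-- The componentwise partial derivative. -/
def pderivOdd3 (k : Fin 3) (x : Odd3 F) : Odd3 F :=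
  (fun a => pderiv F k (x.1 a), fun a s t => pderiv F k (x.2 a s t))

theorem divergence_pderiv (k : Fin 3) (X : Fin 3 → MvPowerSeries (Fin 3) F) :
    (divergence fun t => pderiv F k (X t)) = pderiv F k (divergence X) :=
  (pderiv_divergence k X).symm

theorem pderivEven3_evenEven3 (k : Fin 3) (x y : Even3 F) :
    pderivEven3 k (evenEven3 x y) =
      evenEven3 (pderivEven3 k x) y + evenEven3 x (pderivEven3 k y) := by
  refine Prod.ext (funext fun t => ?_) (Prod.ext ?_ (funext fun s => funext fun t => ?_))
  · exact pderiv_lieVec k x.1 y.1 t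
  · ext1 a b
    simp only [pderivEven3, evenEven3, Matrix.of_apply, Matrix.sub_apply, Matrix.mul_apply,
      map_add, map_sub, pderiv_actFun, Fin.sum_univ_two, Derivation.leibniz, smul_eq_mul,
      Prod.snd_add, Prod.fst_add, Matrix.add_apply]
    ring
  · simp only [pderivEven3, evenEven3, Matrix.of_apply, map_add, map_sub, pderiv_lieForm,
      Fin.sum_univ_two, Derivation.map_smul, pderiv_dWedge, divergence_pderiv, Prod.snd_add,
      Pi.add_apply, smul_add]
    ring

theorem pderivOdd3_evenOdd3 (k : Fin 3) (x : Even3 F) (y : Odd3 F) :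
    pderivOdd3 k (evenOdd3 x y) = evenOdd3 (pderivEven3 k x) y + evenOdd3 x (pderivOdd3 k y) := by
  refine Prod.ext (funext fun a => ?_) (funext fun a => funext fun s => funext fun t => ?_)
  · simp only [pderivEven3, pderivOdd3, evenOdd3, Matrix.of_apply, map_add, map_sub, pderiv_actFun,
      Fin.sum_univ_two, Derivation.map_smul, Derivation.leibniz, smul_eq_mul, divergence_pderiv,
      Prod.fst_add, Pi.add_apply, smul_add]
    simp only [Algebra.smul_def]
    ring
  · simp only [pderivEven3, pderivOdd3, evenOdd3, Matrix.of_apply, map_add, map_sub,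
      pderiv_lieForm, Fin.sum_univ_two, Derivation.map_smul, Derivation.leibniz, smul_eq_mul,
      divergence_pderiv, pderiv_dWedge, Prod.snd_add, Pi.add_apply, smul_add]
    simp only [Algebra.smul_def]
    ring

theorem starVec_pderiv (k : Fin 3) (S : Fin 3 → Fin 3 → MvPowerSeries (Fin 3) F) :
    (starVec fun s t => pderiv F k (S s t)) = fun t => pderiv F k (starVec S t) := rfl

theorem pderiv_symCoeff (k : Fin 3) (x y : Odd3 F) (a b : Fin 2) :
    pderiv F k (symCoeff x.1 y.2 a b) =
      symCoeff (pderivOdd3 k x).1 y.2 a b + symCoeff x.1 (pderivOdd3 k y).2 a b := by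
  simp only [symCoeff, Matrix.of_apply, pderivOdd3, starVec_pderiv, divergence_pderiv,
    Derivation.map_smul, map_sub, pderiv_actFun, Derivation.leibniz, smul_eq_mul]
  simp only [Algebra.smul_def]
  ring

theorem pderivEven3_oddOdd3 (k : Fin 3) (x y : Odd3 F) :
    pderivEven3 k (oddOdd3 x y) = oddOdd3 (pderivOdd3 k x) y + oddOdd3 x (pderivOdd3 k y) := by
  refine Prod.ext (funext fun t => ?_) (Prod.ext ?_ (funext fun s => funext fun t => ?_))
  · simp only [pderivEven3, pderivOdd3, oddOdd3, starVec, map_add, map_sub, pderiv_dWedge,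
      Derivation.leibniz, smul_eq_mul, Prod.fst_add, Pi.add_apply]
    ring
  · have h := fun a b => pderiv_symCoeff k x y a b
    have h' := fun a b => pderiv_symCoeff k y x a b
    ext1 a b
    fin_cases a <;> fin_cases b <;>
      simp [pderivEven3, oddOdd3, symToSl2, h, h'] <;> ring
  · simp only [pderivEven3, pderivOdd3, oddOdd3, starVec_pderiv, divergence_pderiv, map_add,
      map_sub, map_neg, pderiv_dWedge, pderiv_dOne, Prod.snd_add, Pi.add_apply]
    simp only [dOne, crossForm, Pi.sub_apply, map_sub, Derivation.leibniz, smul_eq_mul, map_add]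
    ring

/-- Since ∂_k has divergence zero, the correction terms of the bracket and the half-divergence twist
of the odd part both vanish on it, so ∂_k acts componentwise here too. -/
theorem evenEven3_coordinate (k : Fin 3) (x : Even3 F) :
    evenEven3 (vec k 1, 0, 0) x = pderivEven3 k x := by
  refine Prod.ext (funext fun t => ?_) (Prod.ext ?_ (funext fun s => funext fun t => ?_))
  · exact lieVec_vec_one k x.1 t
  · ext1 a b
    have h0 : actFun x.1 0 = 0 := by simp [actFun]
    simp [evenEven3, pderivEven3, actFun_vec, h0]
  · have h0 : lieForm x.1 0 s t = 0 := by simp [lieForm, actFun]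
    simp [evenEven3, pderivEven3, lieForm_vec_one, divergence_vec, dWedge, h0]

theorem evenOdd3_coordinate (k : Fin 3) (y : Odd3 F) :
    evenOdd3 (vec k 1, 0, 0) y = pderivOdd3 k y := by
  refine Prod.ext (funext fun a => ?_) (funext fun a => funext fun s => funext fun t => ?_)
  · simp [evenOdd3, pderivOdd3, actFun_vec, divergence_vec]
  · simp [evenOdd3, pderivOdd3, lieForm_vec_one, divergence_vec, dWedge]

theorem bracket3_even (u : Even3 F) (y : Even3 F × Odd3 F) :
    bracket3 F (u, 0) y = (evenEven3 u y.1, evenOdd3 u y.2) := by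
  have h1 : bracket3 F (u, 0) y =
      (evenEven3 u y.1 + oddOdd3ₗ 0 y.2, evenOdd3 u y.2 - evenOdd3ₗ y.1 0) := rfl
  rw [h1, map_zero, map_zero, LinearMap.zero_apply, add_zero, sub_zero]

theorem bracket3_odd (v : Odd3 F) (y : Even3 F × Odd3 F) :
    bracket3 F (0, v) y = (oddOdd3 v y.2, -evenOdd3 y.1 v) := by
  have h1 : bracket3 F (0, v) y =
      (evenEven3ₗ 0 y.1 + oddOdd3 v y.2, evenOdd3ₗ 0 y.2 - evenOdd3 y.1 v) := rfl
  rw [h1, map_zero, map_zero, LinearMap.zero_apply, LinearMap.zero_apply, zero_add, zero_sub]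

theorem bracket3_coordinate (k : Fin 3) (y : Even3 F × Odd3 F) :
    bracket3 F ((vec k 1, 0, 0), 0) y = (pderivEven3 k y.1, pderivOdd3 k y.2) := by
  rw [bracket3_even, evenEven3_coordinate, evenOdd3_coordinate]

theorem bracket3_coordinate_leibniz (k : Fin 3) (y z : Even3 F × Odd3 F) :
    bracket3 F ((vec k 1, 0, 0), 0) (bracket3 F y z) =
      bracket3 F (bracket3 F ((vec k 1, 0, 0), 0) y) z
        + bracket3 F y (bracket3 F ((vec k 1, 0, 0), 0) z) := by
  -- Additivity is inherited from the bilinear bracket, of which this map is a partial evaluation.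
  have hadd : ∀ u v : Even3 F, pderivEven3 k (u + v) = pderivEven3 k u + pderivEven3 k v := by
    intro u v
    simp only [← evenEven3_coordinate]
    exact map_add (evenEven3ₗ (vec k 1, 0, 0)) u v
  have hsub : ∀ u v : Odd3 F, pderivOdd3 k (u - v) = pderivOdd3 k u - pderivOdd3 k v := by
    intro u v
    simp only [← evenOdd3_coordinate]
    exact map_sub (evenOdd3ₗ (vec k 1, 0, 0)) u v
  simp only [bracket3_coordinate]
  refine Prod.ext ?_ ?_
  · change pderivEven3 k (evenEven3 y.1 z.1 + oddOdd3 y.2 z.2) =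
      (evenEven3 _ z.1 + oddOdd3 _ z.2) + (evenEven3 y.1 _ + oddOdd3 y.2 _)
    rw [hadd, pderivEven3_evenEven3, pderivEven3_oddOdd3]
    abel
  · change pderivOdd3 k (evenOdd3 y.1 z.2 - evenOdd3 z.1 y.2) =
      (evenOdd3 _ z.2 - evenOdd3 z.1 _) + (evenOdd3 y.1 _ - evenOdd3 _ y.2)
    rw [hsub, pderivOdd3_evenOdd3, pderivOdd3_evenOdd3]
    abel

variable {c : CoeffKind}

/-! ### Test elements f ∂_k and f ⊗ e_a of E(3,8) -/

theorem vector_mem_E38 {Y : Fin 3 → MvPowerSeries (Fin 3) F} (hY : ∀ t, Y t ∈ coeffRing F 3 c) :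
    ((Y, 0, 0), 0) ∈ E38 F c :=
  ⟨⟨hY, fun _ _ => zero_mem _, fun _ _ => zero_mem _, fun _ => zero_mem _,
    fun _ _ _ => zero_mem _⟩, by simp, fun i j => by simp, fun i j k => by simp,
    fun a i j => by simp⟩

theorem function_mem_E38 {h : Fin 2 → MvPowerSeries (Fin 3) F}
    (hh : ∀ a, h a ∈ coeffRing F 3 c) : (0, (h, 0)) ∈ E38 F c :=
  ⟨⟨fun _ => zero_mem _, fun _ _ => zero_mem _, fun _ _ => zero_mem _, hh,
    fun _ _ _ => zero_mem _⟩, by simp, fun i j => by simp, fun i j k => by simp,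
    fun a i j => by simp⟩

theorem even_mem_E38 {x : Even3 F × Odd3 F} (hx : x ∈ E38 F c) : (x.1, 0) ∈ E38 F c := by
  obtain ⟨⟨h1, h2, h3, -, -⟩, h6, h7, h8, -⟩ := hx
  exact ⟨⟨h1, h2, h3, fun _ => zero_mem _, fun _ _ _ => zero_mem _⟩, h6, h7, h8,
    fun a i j => by simp⟩

/-- The element `f ∂_k` of `E(3,8)`. -/
def vectorE38 (k : Fin 3) {f : MvPowerSeries (Fin 3) F} (hf : f ∈ coeffRing F 3 c) : E38 F c :=
  ⟨((vec k f, 0, 0), 0), vector_mem_E38 (vec_mem hf k)⟩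

theorem single_mem {f : MvPowerSeries (Fin 3) F} (hf : f ∈ coeffRing F 3 c) (a b : Fin 2) :
    (Pi.single a f : Fin 2 → MvPowerSeries (Fin 3) F) b ∈ coeffRing F 3 c := by
  rw [Pi.single_apply]
  split_ifs
  · exact hf
  · exact zero_mem _

/-- The element `f ⊗ e_a` of `E(3,8)`. -/
def functionE38 (a : Fin 2) {f : MvPowerSeries (Fin 3) F} (hf : f ∈ coeffRing F 3 c) : E38 F c :=
  ⟨(0, (Pi.single a f, 0)), function_mem_E38 (single_mem hf a)⟩

variable (F c) in
/-- The element `∂_i` of `E(3,8)`. -/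
def coordinateE38 (i : Fin 3) : E38 F c := vectorE38 i (one_mem _)

theorem bracket_coordinateE38 (i : Fin 3) (y : E38 F c) :
    (bracketE38 F c (coordinateE38 F c i) y : Even3 F × Odd3 F) =
      (pderivEven3 i y.1.1, pderivOdd3 i y.1.2) :=
  bracket3_coordinate i y.1

theorem bracket_coordinate_vectorE38 (i k : Fin 3) {f : MvPowerSeries (Fin 3) F}
    (hf : f ∈ coeffRing F 3 c) : bracketE38 F c (coordinateE38 F c i) (vectorE38 k hf) =
      vectorE38 k (pderiv_mem_coeffRing c i hf) := by
  refine Subtype.ext ((bracket_coordinateE38 i _).trans ?_)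
  refine Prod.ext (Prod.ext (funext fun t => pderiv_vec i k t f) (Prod.ext ?_ ?_))
    (Prod.ext ?_ ?_)
  · ext1 a b
    exact map_zero (pderiv F i)
  · funext s t
    exact map_zero (pderiv F i)
  · funext a
    exact map_zero (pderiv F i)
  · funext a s t
    exact map_zero (pderiv F i)

theorem bracket_coordinate_functionE38 (i : Fin 3) (a : Fin 2) {f : MvPowerSeries (Fin 3) F}
    (hf : f ∈ coeffRing F 3 c) : bracketE38 F c (coordinateE38 F c i) (functionE38 a hf) =
      functionE38 a (pderiv_mem_coeffRing c i hf) := by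
  refine Subtype.ext ((bracket_coordinateE38 i _).trans ?_)
  refine Prod.ext (Prod.ext ?_ (Prod.ext ?_ ?_)) (Prod.ext ?_ ?_)
  · funext t
    exact map_zero (pderiv F i)
  · ext1 a b
    exact map_zero (pderiv F i)
  · funext s t
    exact map_zero (pderiv F i)
  · funext b
    exact (Pi.apply_single (fun _ => pderiv F i) (fun _ => map_zero _) a f b)
  · funext a s t
    exact map_zero (pderiv F i)

theorem vectorE38_eq_zero (k : Fin 3) {f : MvPowerSeries (Fin 3) F} (hf : f ∈ coeffRing F 3 c)
    (h0 : f = 0) : vectorE38 k hf = 0 := by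
  subst h0
  exact Subtype.ext (Prod.ext (Prod.ext (vec_zero k) rfl) rfl)

theorem functionE38_eq_zero (a : Fin 2) {f : MvPowerSeries (Fin 3) F} (hf : f ∈ coeffRing F 3 c)
    (h0 : f = 0) : functionE38 a hf = 0 := by
  subst h0
  exact Subtype.ext (Prod.ext rfl (Prod.ext (Pi.single_zero a) rfl))

theorem functionE38_ne_zero (a : Fin 2) {f : MvPowerSeries (Fin 3) F} (hf : f ∈ coeffRing F 3 c)
    (h0 : f ≠ 0) : functionE38 a hf ≠ 0 := by
  intro h
  have h1 : (Pi.single a f : Fin 2 → MvPowerSeries (Fin 3) F) = 0 :=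
    congrArg (fun x : E38 F c => x.1.2.1) h
  exact h0 (Pi.single_eq_zero_iff.1 h1)

theorem divergence_eq_zero {X : Fin 3 → MvPowerSeries (Fin 3) F}
    (h : ∀ k t, pderiv F k (X t) = 0) : divergence X = 0 :=
  Finset.sum_eq_zero fun k _ => h k k

/-- The odd elements `f ⊗ e_b` acting on an element with constant even part. -/
theorem bracket_functionE38 {y : E38 F c} {b : Fin 2} {f : MvPowerSeries (Fin 3) F}
    (hf : f ∈ coeffRing F 3 c) (hv : ∀ k t, pderiv F k (y.1.1.1 t) = 0)
    (hm : ∀ k a b, pderiv F k (y.1.1.2.1 a b) = 0)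
    (h : bracketE38 F c (functionE38 b hf) y = 0) :
    (∀ a, actFun y.1.1.1 ((Pi.single b f : Fin 2 → MvPowerSeries (Fin 3) F) a)
      + y.1.1.2.1 a b * f = 0) ∧ ∀ s t, f * y.1.1.2.2 s t = 0 := by
  have h1 : bracket3 F (0, (Pi.single b f, 0)) y.1 = 0 := congrArg Subtype.val h
  rw [bracket3_odd] at h1
  have h2 : evenOdd3 y.1.1 (Pi.single b f, 0) = 0 := neg_eq_zero.1 (congrArg Prod.snd h1)
  constructor
  · intro a
    have h3 := congrFun (congrArg Prod.fst h2) a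
    simpa [evenOdd3, divergence_eq_zero hv, Pi.single_apply] using h3
  · intro s t
    -- The entry b is the one where the 2-form is multiplied by f; all other contributions contain
    -- derivatives of the constant data.
    have h3 := congrFun (congrFun (congrFun (congrArg Prod.snd h2) b) s) t
    simpa [evenOdd3, divergence_eq_zero hv, dWedge, hm, lieForm, actFun] using h3

/-- The even elements commuting with some `D_j z` (`D_i z = 0`) are the multiples of `D_i`. -/
theorem exists_smul_coordinateE38 [CharZero F] (i : Fin 3) (y : E38 F c)
    (hy : y ∈ parityOn (E38 F c) 0)
    (h : ∀ j ≠ i, ∀ k, ∀ z ∈ parityOn (E38 F c) k, bracketE38 F c (coordinateE38 F c i) z = 0 →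
      bracketE38 F c (bracketE38 F c (coordinateE38 F c j) z) y = 0) :
    ∃ a : F, y = a • coordinateE38 F c i := by
  have hy2 : y.1.2 = 0 := mem_parityOn_zero.1 hy
  have hvec : ∀ j ≠ i, ∀ k (f : MvPowerSeries (Fin 3) F) (hf : f ∈ coeffRing F 3 c),
      pderiv F i f = 0 →
      bracketE38 F c (vectorE38 k (pderiv_mem_coeffRing c j hf)) y = 0 := by
    intro j hj k f hf h0
    have := h j hj 0 (vectorE38 k hf) (mem_parityOn_zero.2 rfl) (by
      rw [bracket_coordinate_vectorE38]
      exact vectorE38_eq_zero _ _ h0)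
    rwa [bracket_coordinate_vectorE38] at this
  have hfun : ∀ j ≠ i, ∀ a (f : MvPowerSeries (Fin 3) F) (hf : f ∈ coeffRing F 3 c),
      pderiv F i f = 0 →
      bracketE38 F c (functionE38 a (pderiv_mem_coeffRing c j hf)) y = 0 := by
    intro j hj a f hf h0
    have := h j hj 1 (functionE38 a hf) (mem_parityOn_one.2 rfl) (by
      rw [bracket_coordinate_functionE38]
      exact functionE38_eq_zero _ _ h0)
    rwa [bracket_coordinate_functionE38] at this
  have hX := X_mem_coeffRing (F := F) (n := 3) c
  obtain ⟨j, hj⟩ : ∃ j, j ≠ i := exists_ne i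
  have hd : ∀ k, pderivEven3 k y.1.1 = 0 := by
    intro k
    -- No divergence condition holds in E(3,8), so x_j ∂_k gives ∂_k for every k, including k = j.
    have h1 := hvec j hj k (X j) (hX j) (pderiv_X_of_ne hj)
    have h2 : bracket3 F ((vec k (pderiv F j (X j)), 0, 0), 0) y.1 = 0 := congrArg Subtype.val h1
    rw [pderiv_X_self, bracket3_coordinate] at h2
    exact congrArg Prod.fst h2
  have hv : ∀ k t, pderiv F k (y.1.1.1 t) = 0 := fun k => congrFun (congrArg Prod.fst (hd k))
  have hm : ∀ k a b, pderiv F k (y.1.1.2.1 a b) = 0 := fun k a b =>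
    congrFun (congrFun (congrArg (fun x : Even3 F => x.2.1) (hd k)) a) b
  -- From x_j ⊗ e_a one gets 1 ⊗ e_a. Its bracket with y detects column a of the matrix and the
  -- 2-form at once, the vector field acting by zero on constants.
  have hone := fun a => bracket_functionE38 _ hv hm
    (hfun j hj a (X j) (hX j) (pderiv_X_of_ne hj))
  have hm0 : ∀ a b, y.1.1.2.1 a b = 0 := by
    intro a b
    have h1 := (hone b).1 a
    rw [pderiv_X_self, mul_one] at h1
    have h2 : actFun y.1.1.1 ((Pi.single b 1 : Fin 2 → MvPowerSeries (Fin 3) F) a) = 0 := by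
      rw [Pi.single_apply]
      split_ifs <;> simp [actFun]
    rwa [h2, zero_add] at h1
  have hω : ∀ s t, y.1.1.2.2 s t = 0 := by
    intro s t
    have h1 := (hone 0).2 s t
    rwa [pderiv_X_self, one_mul] at h1
  have hv0 : ∀ l ≠ i, y.1.1.1 l = 0 := by
    intro l hl
    -- With the matrix gone, the derivative 2x_l ⊗ e_0 detects y_l. The index l = i is unavailable,
    -- because the test function must not involve x_i.
    have h1 := (bracket_functionE38 _ hv hm (hfun l hl 0 (X l * X l) (mul_mem (hX l) (hX l))
      (by simp [pderiv_X_of_ne hl]))).1 0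
    rw [Derivation.leibniz, pderiv_X_self, hm0, zero_mul, add_zero, Pi.single_eq_same, smul_eq_mul,
      mul_one, actFun_add_right, actFun_X, ← two_smul F, smul_eq_zero] at h1
    exact h1.resolve_left two_ne_zero
  obtain ⟨a, ha⟩ := exists_smul_one_of_pderiv fun k => hv k i
  refine ⟨a, Subtype.ext (Prod.ext (Prod.ext (funext fun t => ?_) (Prod.ext ?_ ?_))
    (hy2.trans (smul_zero a).symm))⟩
  · change y.1.1.1 t = a • vec i 1 t
    by_cases ht : t = i
    · rw [ht, ha, vec_self]
    · rw [hv0 t ht, vec_of_ne ht, smul_zero]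
  · ext1 s t
    exact (hm0 s t).trans (smul_zero a).symm
  · funext s t
    exact (hω s t).trans (smul_zero a).symm

/-- A skew array of size 3 has three independent entries, all recorded by `starVec`; the diagonal
vanishes because 2 is invertible. -/
theorem eq_zero_of_starVec {S : Fin 3 → Fin 3 → MvPowerSeries (Fin 3) F} [CharZero F]
    (hS : IsSkew S) (h : starVec S = 0) (s t : Fin 3) : S s t = 0 := by
  have hself : ∀ s, S s s = 0 := by
    intro s
    have h1 : (2 : F) • S s s = 0 := by
      rw [two_smul]
      exact eq_neg_iff_add_eq_zero.1 (hS s s)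
    exact (smul_eq_zero.1 h1).resolve_left two_ne_zero
  have h0 : S 1 2 = 0 := congrFun h 0
  have h1 : S 2 0 = 0 := congrFun h 1
  have h2 : S 0 1 = 0 := congrFun h 2
  have h0' : S 2 1 = 0 := by rw [hS 1 2, h0, neg_zero]
  have h1' : S 0 2 = 0 := by rw [hS 2 0, h1, neg_zero]
  have h2' : S 1 0 = 0 := by rw [hS 0 1, h2, neg_zero]
  fin_cases s <;> fin_cases t <;> first | exact hself _ | assumption

/-- The elements `D_i z`, where `z` is killed by some `D_m`, have trivial centralizer. -/
theorem eq_zero_of_bracketE38 [CharZero F] (i : Fin 3) (y : E38 F c)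
    (h : ∀ k, ∀ z ∈ parityOn (E38 F c) k, (∃ m, bracketE38 F c (coordinateE38 F c m) z = 0) →
      bracketE38 F c (bracketE38 F c (coordinateE38 F c i) z) y = 0) : y = 0 := by
  obtain ⟨-, -, -, -, hskew⟩ := y.2
  have hvec : ∀ k (f : MvPowerSeries (Fin 3) F) (hf : f ∈ coeffRing F 3 c),
      (∃ m, pderiv F m f = 0) →
      bracketE38 F c (vectorE38 k (pderiv_mem_coeffRing c i hf)) y = 0 := by
    rintro k f hf ⟨m, h0⟩
    have := h 0 (vectorE38 k hf) (mem_parityOn_zero.2 rfl) ⟨m, by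
      rw [bracket_coordinate_vectorE38]
      exact vectorE38_eq_zero _ _ h0⟩
    rwa [bracket_coordinate_vectorE38] at this
  have hfun : ∀ a (f : MvPowerSeries (Fin 3) F) (hf : f ∈ coeffRing F 3 c),
      (∃ m, pderiv F m f = 0) →
      bracketE38 F c (functionE38 a (pderiv_mem_coeffRing c i hf)) y = 0 := by
    rintro a f hf ⟨m, h0⟩
    have := h 1 (functionE38 a hf) (mem_parityOn_one.2 rfl) ⟨m, by
      rw [bracket_coordinate_functionE38]
      exact functionE38_eq_zero _ _ h0⟩
    rwa [bracket_coordinate_functionE38] at this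
  have hX := X_mem_coeffRing (F := F) (n := 3) c
  have hne : ∀ l, ∃ m, m ≠ i ∧ m ≠ l :=
    (by decide : ∀ i l : Fin 3, ∃ m, m ≠ i ∧ m ≠ l) i
  obtain ⟨j, hj, -⟩ := hne i
  have hd : ∀ k, pderivEven3 k y.1.1 = 0 ∧ pderivOdd3 k y.1.2 = 0 := by
    intro k
    have h1 := hvec k (X i) (hX i) ⟨j, pderiv_X_of_ne hj.symm⟩
    have h2 : bracket3 F ((vec k (pderiv F i (X i)), 0, 0), 0) y.1 = 0 := congrArg Subtype.val h1
    rw [pderiv_X_self, bracket3_coordinate] at h2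
    exact ⟨congrArg Prod.fst h2, congrArg Prod.snd h2⟩
  have hv : ∀ k t, pderiv F k (y.1.1.1 t) = 0 := fun k => congrFun (congrArg Prod.fst (hd k).1)
  have hm : ∀ k a b, pderiv F k (y.1.1.2.1 a b) = 0 := fun k a b =>
    congrFun (congrFun (congrArg (fun x : Even3 F => x.2.1) (hd k).1) a) b
  have hg : ∀ k a, pderiv F k (y.1.2.1 a) = 0 := fun k => congrFun (congrArg Prod.fst (hd k).2)
  have hone := fun a => hfun a (X i) (hX i) ⟨j, pderiv_X_of_ne hj.symm⟩
  have hm0 : ∀ a b, y.1.1.2.1 a b = 0 := by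
    intro a b
    have h1 := (bracket_functionE38 _ hv hm (hone b)).1 a
    rw [pderiv_X_self, mul_one] at h1
    have h2 : actFun y.1.1.1 ((Pi.single b 1 : Fin 2 → MvPowerSeries (Fin 3) F) a) = 0 := by
      rw [Pi.single_apply]
      split_ifs <;> simp [actFun]
    rwa [h2, zero_add] at h1
  have hω : ∀ s t, y.1.1.2.2 s t = 0 := by
    intro s t
    have h1 := (bracket_functionE38 _ hv hm (hone 0)).2 s t
    rwa [pderiv_X_self, one_mul] at h1
  have hv0 : ∀ l, y.1.1.1 l = 0 := by
    intro l
    obtain ⟨m, hmi, hml⟩ := hne l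
    -- The derivative of x_i x_l along x_i is x_l, or 2x_i when l = i; either one detects y_l. A
    -- coordinate x_m is always left over.
    have h1 := (bracket_functionE38 _ hv hm (hfun 0 (X i * X l) (mul_mem (hX i) (hX l))
      ⟨m, by simp [pderiv_X_of_ne hmi.symm, pderiv_X_of_ne hml.symm]⟩)).1 0
    rw [Derivation.leibniz, pderiv_X_self, hm0, zero_mul, add_zero, Pi.single_eq_same, smul_eq_mul,
      smul_eq_mul, mul_one, actFun_add_right, actFun_X] at h1
    by_cases hli : l = i
    · rw [hli, pderiv_X_self, mul_one, actFun_X, ← two_smul F, smul_eq_zero] at h1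
      rw [hli]
      exact h1.resolve_left two_ne_zero
    · rw [pderiv_X_of_ne hli, mul_zero] at h1
      simpa [actFun] using h1
  -- Through the factor det(u,v), 1 ⊗ e_0 pairs with the 2-form at e_1 and 1 ⊗ e_1 with the one at
  -- e_0; hence the crossed indices below.
  have hS : ∀ b k, starVec (y.1.2.2 b) k = 0 := by
    have h1 : ∀ b, oddOdd3 (Pi.single b 1, 0) y.1.2 = 0 := by
      intro b
      have h2 : bracket3 F (0, (Pi.single b (pderiv F i (X i)), 0)) y.1 = 0 :=
        congrArg Subtype.val (hone b)
      rw [pderiv_X_self, bracket3_odd] at h2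
      exact congrArg Prod.fst h2
    intro b k
    fin_cases b
    · have h2 := congrFun (congrArg Prod.fst (h1 1)) k
      simpa [oddOdd3, starVec, dWedge, hg] using h2
    · have h2 := congrFun (congrArg Prod.fst (h1 0)) k
      simpa [oddOdd3, starVec, dWedge, hg] using h2
  have hg0 : ∀ a, y.1.2.1 a = 0 := by
    intro a
    -- The functions g_a are already constant, so the field 2x_i ∂_i acts on them only through the
    -- twist by minus half its divergence, that is, by -1.
    have h1 := hvec i (X i * X i) (mul_mem (hX i) (hX i)) ⟨j, by simp [pderiv_X_of_ne hj.symm]⟩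
    have h2 : bracket3 F ((vec i (pderiv F i (X i * X i)), 0, 0), 0) y.1 = 0 :=
      congrArg Subtype.val h1
    rw [bracket3_even] at h2
    have h3 := congrFun (congrArg (fun x : Even3 F × Odd3 F => x.2.1) h2) a
    simp [evenOdd3, actFun_vec, hg, divergence_vec] at h3
    -- The other alternative is 1 + 1 = 0 as a power series, refuted by its constant term.
    refine h3.resolve_left fun h4 => two_ne_zero (α := F) ?_
    have h5 := congrArg (constantCoeff (σ := Fin 3) (R := F)) h4
    rw [map_add, map_one, map_zero, one_add_one_eq_two] at h5
    exact h5
  refine Subtype.ext (Prod.ext (Prod.ext (funext hv0) (Prod.ext ?_ ?_)) (Prod.ext (funext hg0) ?_))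
  · ext1 a b
    exact hm0 a b
  · funext s t
    exact hω s t
  · funext a s t
    exact eq_zero_of_starVec (hskew a) (funext (hS a)) s t

theorem exists_bracketE38_ne_zero (i j : Fin 3) (hij : i ≠ j) :
    ∃ k, ∃ z ∈ parityOn (E38 F c) k,
      bracketE38 F c (coordinateE38 F c i) (bracketE38 F c (coordinateE38 F c j) z) ≠ 0 := by
  refine ⟨1, functionE38 0 (mul_mem (X_mem_coeffRing c i) (X_mem_coeffRing c j)),
    mem_parityOn_one.2 rfl, ?_⟩
  rw [bracket_coordinate_functionE38, bracket_coordinate_functionE38]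
  refine functionE38_ne_zero _ _ ?_
  simp [pderiv_X_of_ne hij]

theorem eq_id_E38 [CharZero F] {σ : E38 F c →ₗ[F] E38 F c}
    (h : IsHomLieStructure (parityOn (E38 F c)) (bracketE38 F c) σ) (hσ : σ ≠ 0) (x : E38 F c) :
    σ x = x := by
  refine h.eq_id hσ (exists_parityOn_add fun _ => even_mem_E38) (coordinateE38 F c)
    (fun i => mem_parityOn_zero.2 rfl) (fun i j => ?_)
    (fun i y z => Subtype.ext (bracket3_coordinate_leibniz i y.1 z.1))
    exists_smul_coordinateE38 exists_bracketE38_ne_zero eq_zero_of_bracketE38 inferInstance x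
  refine (bracket_coordinate_vectorE38 i j _).trans (vectorE38_eq_zero _ _ ?_)
  exact Derivation.map_one_eq_zero _

end ThreeVariables

end ExcLie

end

/-! ### The theorem for the three algebras -/

theorem mainTheorem3 (F : Type*) [Field F] [IsAlgClosed F] [CharZero F] (c : CoeffKind) :
    (∀ σ : E510 F c →ₗ[F] E510 F c,
      IsHomLieStructure (parityOn (E510 F c)) (bracketE510 F c) σ → σ ≠ 0 →
        (∀ x ∈ gradeE510 F c (-1), σ x = x) ∧ (∀ x ∈ gradeE510 F c 0, σ x = x)) ∧
    (∀ σ : E36 F c →ₗ[F] E36 F c,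
      IsHomLieStructure (parityOn (E36 F c)) (bracketE36 F c) σ → σ ≠ 0 →
        (∀ x ∈ gradeE36 F c (-1), σ x = x) ∧ (∀ x ∈ gradeE36 F c 0, σ x = x)) ∧
    (∀ σ : E38 F c →ₗ[F] E38 F c,
      IsHomLieStructure (parityOn (E38 F c)) (bracketE38 F c) σ → σ ≠ 0 →
        (∀ x ∈ gradeE38 F c (-1), σ x = x) ∧ (∀ x ∈ gradeE38 F c 0, σ x = x)) := by
  refine ⟨fun σ h hσ => ?_, fun σ h hσ => ?_, fun σ h hσ => ?_⟩
  -- The bracket attached to a coordinate subalgebra and `bracketE510` are the same restriction of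
  -- `bracket5` up to the closure proof, so `h` applies by definitional equality.
  · have := (isCoordinateSubalgebra_E510 (F := F) c).eq_id inferInstance h hσ
    exact ⟨fun x _ => this x, fun x _ => this x⟩
  · have := (isCoordinateSubalgebra_E36 (F := F) c).eq_id inferInstance h hσ
    exact ⟨fun x _ => this x, fun x _ => this x⟩
  · exact ⟨fun x _ => eq_id_E38 h hσ x, fun x _ => eq_id_E38 h hσ x⟩
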